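/- **Setting.** Let $I=[0,1]$. The Haar quarks are $\varphi_p(x)=x^p\chi_{[0,1)}(x)$, $p\in\mathbb N_0$, and the Haar quarklets are $\psi_p=\varphi_p(2\cdot)-\varphi_p(2\cdot-1)$; put $\psi_{p,j,k}=2^{j/2}\psi_p(2^j\cdot-k)$ for $j\ge 0$, $0\le k<2^j$, and $\psi_{p,-1,0}=\varphi_p$. Let $\Lambda_I$ be the set of all these indices $(p,j,k)$. Let $w_p\ge 0$ be weights with $w_0=1$ and $\sum_p w_p(p+1)^{-1/2}<\infty$. *Trees.* A node is a pair $\lambda=(j,k)$, $j\ge0$, $0\le k<2^j$, with dyadic interval $I_\lambda=2^{-j}[k,k+1)$, level $|\lambda|=j$ and children $(j+1,2k),(j+1,2k+1)$; $\mu\prec\lambda$ means $I_\lambda\subsetneq I_\mu$. The quark index $(-1,0)$ is assigned to the root $\mathcal R=(0,0)$: in all sums and index sets below, the indices $(p,-1,0)$ are treated as belonging to the node $\mathcal R$. A tree is a finite set $\mathcal T\ni\mathcal R$ of nodes which contains all ancestors of its elements and in which every node has zero or two children; $\mathcal V(\mathcal T)$ is the set of its leaves, and $r(\lambda,\mathcal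 T)$ is the number of leaves $\eta\succeq\lambda$ of $\mathcal T$ minus one. For every node $\lambda$ fix $\mu_\lambda\preceq\lambda$ and put $\Upsilon(\lambda)=\{\mu:\mu_\lambda\preceq\mu\preceq\lambda\}$, where it is required that for every tree $\mathcal T$ the sets $\Upsilon(\lambda)$, $\lambda\in\mathcal V(\mathcal T)$, form a disjoint decomposition of $\mathcal T$. A quarklet tree $T=(\mathcal T,P_{\max})$ consists of a tree $\mathcal T$ and degrees $p_{\max}(\lambda)\in\mathbb N_0$ for $\lambda\in\mathcal V(\mathcal T)$, extended by $p_{\max}(\mu)=p_{\max}(\lambda)$ for $\mu\in\Upsilon(\lambda)$; it is identified with the set of indices $(p,j,k)$ whose node lies in $\mathcal T$ and which satisfy $p\le p_{\max}$ at that node. Put $\#T=|\mathcal T|+\sum_{\mu\in\mathcal T}p_{\max}(\mu)$. *Errors.* Let $f\in L_2(I)$ be given as $f=\sum_{(p,j,k)\in\Lambda_I}c_{p,j,k}w_p\psi_{p,j,k}$ with real $\mathbf c\in\ell_2(\Lambda_I)$. Put $$e_p(\lambda)=\sum_{(i,\ell)\in\Upsilon(\lambda)}\sum_{q>p}|c_{q,i,\ell}|^2+\sum_{(i,\ell)\succ\lambda}\sum_{q\ge0}|c_{q,i,\ell}|^2,\qquad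 \mathcal E(T)=\sum_{\lambda\in\mathcal V(\mathcal T)}e_{p_{\max}(\lambda)}(\lambda),\qquad \sigma_n=\inf_{\#T\le n}\mathcal E(T).$$ *Algorithm.* With $0\cdot0/(0+0):=0$, put $\tilde e(\mathcal R)=e_0(\mathcal R)$ and $\tilde e(\lambda)=\frac{e_0(\lambda)\tilde e(\mu)}{e_0(\lambda)+\tilde e(\mu)}$ if $\mu$ is the parent of $\lambda$. For a tree $\mathcal T$ put $E(\lambda)=e_0(\lambda)$ on leaves and $E(\lambda)=\min\{E(\eta_1)+E(\eta_2),e_{r(\lambda,\mathcal T)}(\lambda)\}$ on inner nodes with children $\eta_1,\eta_2$. Starting with $\mathcal T_0'=\{\mathcal R\}$, the tree $\mathcal T'_{N}$ arises from $\mathcal T'_{N-1}$ by adding the two children of a leaf reached from $\mathcal R$ by moving always to a child with maximal $q$ (ties broken arbitrarily), where $q(\lambda)=\tilde e(\lambda)$ on leaves and $q(\lambda)=\min\{\max\{q(\eta_1),q(\eta_2)\},\tilde E(\lambda)\}$ on inner nodes; here $\tilde E(\lambda)$ starts as $\tilde e(\lambda)$ and, whenever $r(\lambda,\cdot)$ increases,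 is replaced by $\frac{E(\lambda)\tilde E(\lambda)}{E(\lambda)+\tilde E(\lambda)}$ with $E(\lambda)$ taken for the new tree. Trimming: $\mathcal T_N$ arises from $\mathcal T_N'$ by removing all descendants of those nodes $\lambda$ with $E(\lambda)=e_{r(\lambda,\mathcal T_N')}(\lambda)$. Let $T_N=(\mathcal T_N,P_{\max})$ with $p_{\max}(\lambda)=r(\lambda,\mathcal T'_N)$ for $\lambda\in\mathcal V(\mathcal T_N)$, and let $$f_{T_N}=\sum_{(p,j,k)\in T_N}c_{p,j,k}w_p\psi_{p,j,k}.$$ **Lemma.** There is a constant $C>0$, depending only on the weights $(w_p)$, such that for all admissible $\Upsilon$, all $f$ and $\mathbf c$ as above, all $N\ge1$ and all $1\le n\le N$, $$\|f-f_{T_N}\|_{L_2(I)}^2\le C\,\frac{2N+1}{N-n+1}\,\sigma_n .$$ Moreover, the number of indices in $T_N$ is at most $K\,N$, with a constant $K$ depending only on the maximal level $\max_{\lambda\in\mathcal T_N}|\lambda|$. -/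

import Mathlib

open MeasureTheory

noncomputable section

namespace HaarQuarklet

/-! ### Dyadic nodes and wavelet trees on the unit interval -/

/-- A wavelet index `(j, k)` with `j ≥ 0` and `0 ≤ k < 2 ^ j`. -/
@[ext]
structure Node where
  level : ℕ
  pos : ℕ
  pos_lt : pos < 2 ^ level

instance : DecidableEq Node := Classical.decEq _

namespace Node

/-- The root `(0, 0)`. -/
def root : Node := ⟨0, 0, by norm_num⟩

/-- The child `(j + 1, 2 k)`. -/
def left (l : Node) : Node :=
  ⟨l.level + 1, 2 * l.pos, by have := l.pos_lt; rw [pow_succ]; omega⟩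

/-- The child `(j + 1, 2 k + 1)`. -/
def right (l : Node) : Node :=
  ⟨l.level + 1, 2 * l.pos + 1, by have := l.pos_lt; rw [pow_succ]; omega⟩

/-- The parent `(j - 1, ⌊k / 2⌋)` of a node with `j ≥ 1` (the root is sent to itself). -/
def parent (l : Node) : Node :=
  ⟨l.level - 1, l.pos / 2, by
    have h := l.pos_lt
    rcases Nat.eq_zero_or_pos l.level with h0 | h0
    · rw [h0] at h ⊢
      norm_num at h ⊢
      omega
    · obtain ⟨m, hm⟩ := Nat.exists_eq_succ_of_ne_zero h0.ne'
      rw [hm, Nat.succ_eq_add_one, pow_succ] at h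
      rw [hm, Nat.succ_eq_add_one, Nat.add_sub_cancel]
      omega⟩

/-- The dyadic interval `2^{-j} [k, k + 1)`. -/
def interval (l : Node) : Set ℝ :=
  Set.Ico ((l.pos : ℝ) / 2 ^ l.level) (((l.pos : ℝ) + 1) / 2 ^ l.level)

/-- `m ≺ l`: `m` is a (proper) ancestor of `l`, i.e. `l` is a descendant of `m`. -/
def IsAnc (m l : Node) : Prop := l.interval ⊂ m.interval

/-- `m ⪯ l`: `m` is an ancestor of `l` or equal to `l`. -/
def IsAncEq (m l : Node) : Prop := m.IsAnc l ∨ m = l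

end Node

open Node

/-- Finite complete wavelet trees with root `(0, 0)`. -/
structure IsTree (T : Finset Node) : Prop where
  root_mem : root ∈ T
  anc_mem : ∀ l ∈ T, ∀ m : Node, m.IsAnc l → m ∈ T
  complete : ∀ l ∈ T, (l.left ∈ T ↔ l.right ∈ T)

open Classical in
/-- The leaves `𝒱(T)`: the elements of `T` without descendants in `T`. -/
def leaves (T : Finset Node) : Finset Node := T.filter fun l => ∀ m ∈ T, ¬ l.IsAnc m

open Classical in
/-- `r(l, T) = |𝒱(𝒥_l ∩ T)| - 1`, where `𝒥_l` is the infinite tree of all `m ⪰ l`. -/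
def refCount (T : Finset Node) (l : Node) : ℕ :=
  (leaves (T.filter fun m => l.IsAncEq m)).card - 1

/-! ### Enrichment sets and quarklet trees -/

/-- `Υ(l) = {m : l ⪰ m ⪰ μ_l}`, where `top l = μ_l`. -/
def Ups (top : Node → Node) (l : Node) : Set Node :=
  {m | m.IsAncEq l ∧ (top l).IsAncEq m}

/-- The requirements on the sets `Υ(l)`: `μ_l ⪯ l`, and for every tree `T` the sets `Υ(l)`, with
`l` running over the leaves of `T`, form a disjoint decomposition of `T`. In particular `Υ(η₁)` and
`Υ(η₂)` are disjoint for siblings `η₁`, `η₂`. -/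
structure IsEnrichment (top : Node → Node) : Prop where
  top_ancEq : ∀ l, (top l).IsAncEq l
  disjoint : ∀ T, IsTree T → ∀ l ∈ leaves T, ∀ m ∈ leaves T, l ≠ m →
    Disjoint (Ups top l) (Ups top m)
  cover : ∀ T, IsTree T → ⋃ l ∈ leaves T, Ups top l = (T : Set Node)

open Classical in
/-- A quarklet tree is given by a wavelet tree `T` and the maximal degrees `P l` on the leaves `l`
of `T`. This is the induced maximal degree on all nodes of `T`: it equals `P l` on `Υ(l)` for every
leaf `l` (exactly one leaf contributes to the supremum). -/
def pmax (top : Node → Node) (T : Finset Node) (P : Node → ℕ) (m : Node) : ℕ :=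
  ((leaves T).filter fun l => m ∈ Ups top l).sup P

/-- `#(T, P) = |T| + ∑_{m ∈ T} pmax(m)`: the number of quarklet indices `(p, j, k)`, `j ≥ 0`, in
the quarklet tree. -/
def qcard (top : Node → Node) (T : Finset Node) (P : Node → ℕ) : ℕ :=
  T.card + ∑ m ∈ T, pmax top T P m

/-- Quarklet indices on the unit interval. `(p, some (j, k))` is the index `(p, j, k)` with
`j ≥ 0`, and `(p, none)` is the quark index `(p, -1, 0)`. -/
abbrev QIdx : Type := ℕ × Option Node

/-- The tree node to which a wavelet index is assigned; the quark index `(-1, 0)` is assigned to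
the root. -/
def base (a : Option Node) : Node := a.getD root

/-- All quarklet indices in the quarklet tree `(T, P)`, including the quark indices `(p, -1, 0)`
with `p ≤ pmax(root)`. -/
def indices (top : Node → Node) (T : Finset Node) (P : Node → ℕ) : Finset QIdx :=
  (Finset.insertNone T).biUnion fun a =>
    (Finset.range (pmax top T P (base a) + 1)).image fun p => (p, a)

/-! ### Global error and best approximation error, for given local errors `e p l` -/

/-- The global error `ℰ(T, P)`. -/
def globalErr (e : ℕ → Node → ℝ) (T : Finset Node) (P : Node → ℕ) : ℝ :=
  ∑ l ∈ leaves T, e (P l) l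

/-- The error `σ_n` of the best quarklet tree approximation of cardinality `n`. -/
def bestErr (top : Node → Node) (e : ℕ → Node → ℝ) (n : ℕ) : ℝ :=
  sInf {x | ∃ (T : Finset Node) (P : Node → ℕ),
    IsTree T ∧ qcard top T P ≤ n ∧ x = globalErr e T P}

/-! ### The algorithm NEARBEST_TREE and trimming -/

/-- `a b / (a + b)`, which is `0` for `a = b = 0`. -/
def harm (a b : ℝ) : ℝ := a * b / (a + b)

/-- The modified local error `ẽ`. -/
def modErr (e : ℕ → Node → ℝ) (l : Node) : ℝ :=
  if h : l.level = 0 then e 0 l else harm (e 0 l) (modErr e l.parent)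
termination_by l.level
decreasing_by
  simp only [Node.parent]
  omega

/-- The error functional `E(l, T)`. -/
def treeErr (e : ℕ → Node → ℝ) (T : Finset Node) (l : Node) : ℝ :=
  if h : l.left ∈ T ∧ l.right ∈ T then
    min (treeErr e T l.left + treeErr e T l.right) (e (refCount T l) l)
  else e 0 l
termination_by T.sup Node.level + 1 - l.level
decreasing_by
  · have := Finset.le_sup (f := Node.level) h.1
    simp only [Node.left] at this ⊢
    omega
  · have := Finset.le_sup (f := Node.level) h.2
    simp only [Node.right] at this ⊢
    omega

/-- For a growing sequence of trees `S 0, S 1, …`, the functional `Ẽ_{r(l)}(l)` at stage `k`, i.e.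
with `r(l) = r(l, S k)`: it starts with `ẽ(l)` and is updated to
`Ẽ_r(l) = E_r(l) Ẽ_{r-1}(l) / (E_r(l) + Ẽ_{r-1}(l))` whenever `r(l)` increases. -/
def penErr (e : ℕ → Node → ℝ) (S : ℕ → Finset Node) : ℕ → Node → ℝ
  | 0, l => modErr e l
  | k + 1, l =>
    if refCount (S (k + 1)) l = refCount (S k) l then penErr e S k l
    else harm (treeErr e (S (k + 1)) l) (penErr e S k l)

/-- The function `q` at stage `k`, i.e. with respect to the tree `S k`. -/
def thr (e : ℕ → Node → ℝ) (S : ℕ → Finset Node) (k : ℕ) (l : Node) : ℝ :=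
  if h : l.left ∈ S k ∧ l.right ∈ S k then
    min (max (thr e S k l.left) (thr e S k l.right)) (penErr e S k l)
  else modErr e l
termination_by (S k).sup Node.level + 1 - l.level
decreasing_by
  · have := Finset.le_sup (f := Node.level) h.1
    simp only [Node.left] at this ⊢
    omega
  · have := Finset.le_sup (f := Node.level) h.2
    simp only [Node.right] at this ⊢
    omega

/-- `PointsTo q T l m`: `m` is an admissible value of `s(l)`, i.e. `m` is a leaf reached from `l` by
moving in every step to a child with maximal `q`. Ties may be broken in any way. -/
inductive PointsTo (q : Node → ℝ) (T : Finset Node) : Node → Node → Prop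
  | leaf (l : Node) : l ∈ leaves T → PointsTo q T l l
  | left (l m : Node) : l.left ∈ T → q l.right ≤ q l.left → PointsTo q T l.left m → PointsTo q T l m
  | right (l m : Node) : l.right ∈ T → q l.left ≤ q l.right → PointsTo q T l.right m →
      PointsTo q T l m

/-- `S 0, …, S N` are the trees `𝒯'_0, …, 𝒯'_N` of a run of NEARBEST_TREE with `N` steps. -/
def IsRun (e : ℕ → Node → ℝ) (S : ℕ → Finset Node) (N : ℕ) : Prop :=
  S 0 = {root} ∧ ∀ k < N, ∃ l, PointsTo (thr e S k) (S k) root l ∧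
    S (k + 1) = S k ∪ {l.left, l.right}

open Classical in
/-- Trimming: all descendants of nodes `m` with `E(m) = e_{r(m)}(m)` are removed. -/
def trim (e : ℕ → Node → ℝ) (T : Finset Node) : Finset Node :=
  T.filter fun l => ∀ m ∈ T, m.IsAnc l → treeErr e T m ≠ e (refCount T m) m

/-! ### Haar quarks and quarklets -/

/-- The Haar quark `φ_p(x) = x ^ p` on `[0, 1)`, and `0` elsewhere. -/
def quark (p : ℕ) : ℝ → ℝ := Set.indicator (Set.Ico 0 1) fun x => x ^ p

/-- The Haar quarklet `ψ_p = φ_p(2 ·) - φ_p(2 · - 1)`. -/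
def quarklet (p : ℕ) (x : ℝ) : ℝ := quark p (2 * x) - quark p (2 * x - 1)

/-- `ψ_{p,j,k} = 2^{j/2} ψ_p(2^j · - k)` for `j ≥ 0`, and `ψ_{p,-1,0} = φ_p`. -/
def quarkletFun : QIdx → ℝ → ℝ
  | (p, none), x => quark p x
  | (p, some l), x => (2 : ℝ) ^ ((l.level : ℝ) / 2) * quarklet p (2 ^ l.level * x - l.pos)

/-- Lebesgue measure on `I = [0, 1]`. -/
abbrev muI : Measure ℝ := volume.restrict (Set.Icc 0 1)

theorem measurable_quark (p : ℕ) : Measurable (quark p) :=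
  (measurable_id.pow_const p).indicator measurableSet_Ico

theorem abs_quark_le (p : ℕ) (x : ℝ) : |quark p x| ≤ 1 := by
  unfold quark
  by_cases h : x ∈ Set.Ico (0 : ℝ) 1
  · rw [Set.indicator_of_mem h, abs_of_nonneg (pow_nonneg h.1 p)]
    exact pow_le_one₀ h.1 h.2.le
  · rw [Set.indicator_of_notMem h]
    simp

theorem memLp_quarkletFun (x : QIdx) : MemLp (quarkletFun x) 2 muI := by
  obtain ⟨p, _ | l⟩ := x
  · refine MemLp.of_bound (measurable_quark p).aestronglyMeasurable 1 (ae_of_all _ fun t => ?_)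
    exact abs_quark_le p t
  · have hm : Measurable (quarkletFun (p, some l)) := by
      have := measurable_quark p
      unfold quarkletFun quarklet
      fun_prop
    refine MemLp.of_bound hm.aestronglyMeasurable ((2 : ℝ) ^ ((l.level : ℝ) / 2) * 2)
      (ae_of_all _ fun t => ?_)
    simp only [quarkletFun, quarklet, norm_mul, Real.norm_eq_abs]
    rw [abs_of_nonneg (Real.rpow_nonneg (by norm_num : (0 : ℝ) ≤ 2) _)]
    refine mul_le_mul_of_nonneg_left ?_ (by positivity)
    refine (abs_sub _ _).trans ?_
    linarith [abs_quark_le p (2 * (2 ^ l.level * t - l.pos)),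
      abs_quark_le p (2 * (2 ^ l.level * t - l.pos) - 1)]

/-- The quarklet `ψ_{p,j,k}` as an element of `L_2(I)`. -/
def quarkletL2 (x : QIdx) : Lp ℝ 2 muI := (memLp_quarkletFun x).toLp (quarkletFun x)

/-- The local errors `e_p(l)` of a coefficient sequence `c`. -/
def localErr (top : Node → Node) (c : QIdx → ℝ) (p : ℕ) (l : Node) : ℝ :=
  (∑' x : {x : QIdx // base x.2 ∈ Ups top l ∧ p < x.1}, |c x| ^ 2) +
    ∑' x : {x : QIdx // l.IsAnc (base x.2)}, |c x| ^ 2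

/-- The finite part `∑_{x ∈ A} c_x w_p ψ_x` of a quarklet expansion. -/
def partialSum (w : ℕ → ℝ) (c : QIdx → ℝ) (A : Finset QIdx) : Lp ℝ 2 muI :=
  ∑ x ∈ A, (c x * w x.1) • quarkletL2 x

end HaarQuarklet

end

/-! Two independent estimates are combined.

The first is combinatorial. It uses only that local errors are nonnegative, decrease with the degree
and are subadditive under refinement (`IsLocalError`). Let `t` be the value of `q` at the root after
`N` steps. For positive errors an update of the penalised error reads 1/Ẽ_r = 1/E_r + 1/Ẽ_{r-1}.
Since E_j ≤ e_j ≤ e_p for j ≥ p, this gives (r - p + 1) Ẽ_r ≤ e_p. A count r(λ) grows only when λ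
lies on the selected path, and then Ẽ(λ) ≥ q(λ) ≥ q(root) ≥ t, because `q` decreases in time; hence
(r(λ) - p) t ≤ e_p(λ) (`mul_thr_le`). Over the leaves of a competitor of cardinality at most n, the
counts exceed the degrees by at least N - n + 1 in total, so (N - n + 1) t ≤ σ_n
(`mul_thr_le_bestErr`). Conversely, E decreases in time, so the same identity gives E_r ≤ Ẽ_r (r +
E_r/ẽ). Applied where Ẽ has fallen to `t` and carried up to the root through 1/ẽ(child) =
1/e_0(child) + 1/ẽ(parent), it yields E(root) ≤ (2N + 1) t (`treeErr_root_le`). Trimming gives a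
quarklet tree of global error at most E(root).

The second is analytic: finite weighted expansions satisfy ‖Σ‖² ≤ C Σ|c|²
(`exists_norm_partialSum_sq_le`). For a fixed degree p, quarklets have mean zero, L1 norm at most
2^{-j/2}/(p+1), and variation bounded uniformly in p up to the factor 2^{j/2}. Level by level, the
Gram row sums thus decay geometrically in the level distance, and the Schur test gives a bound of
order 1/(p+1). Cauchy–Schwarz over the degrees brings in the weights. The error sets of the leaves
cover all indices outside the tree, so the global error controls the L2 error. -/

namespace HaarQuarklet

open Node

/-! ### Arithmetic of the ancestor order on dyadic nodes -/

namespace Node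

/-- Translates the order on real intervals into natural-number division: going up `i` levels divides
the position by `2 ^ i`. Comparing interval lengths forces the order of the levels. -/
theorem interval_subset_iff (m l : Node) :
    l.interval ⊆ m.interval ↔ ∃ i, l.level = m.level + i ∧ l.pos / 2 ^ i = m.pos := by
  have key : l.interval ⊆ m.interval ↔ (m.pos : ℝ) / 2 ^ m.level ≤ l.pos / 2 ^ l.level ∧
      ((l.pos : ℝ) + 1) / 2 ^ l.level ≤ (m.pos + 1) / 2 ^ m.level := by
    unfold interval
    rw [Set.Ico_subset_Ico_iff]
    gcongr
    linarith
  have shift : ∀ i, l.level = m.level + i →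
      (l.interval ⊆ m.interval ↔ l.pos / 2 ^ i = m.pos) := by
    intro i hi
    have hM : (0 : ℝ) < 2 ^ m.level := by positivity
    have hI : (0 : ℝ) < 2 ^ i := by positivity
    rw [key, hi, pow_add, Nat.div_eq_iff (by positivity)]
    have h1 : (m.pos : ℝ) / 2 ^ m.level ≤ l.pos / (2 ^ m.level * 2 ^ i) ↔
        m.pos * 2 ^ i ≤ l.pos := by
      rw [div_le_div_iff₀ hM (by positivity), mul_comm ((2 : ℝ) ^ m.level), ← mul_assoc,
        mul_le_mul_iff_left₀ hM]
      exact_mod_cast Iff.rfl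
    have h2 : ((l.pos : ℝ) + 1) / (2 ^ m.level * 2 ^ i) ≤ (m.pos + 1) / 2 ^ m.level ↔
        l.pos + 1 ≤ (m.pos + 1) * 2 ^ i := by
      rw [div_le_div_iff₀ (by positivity) hM, mul_comm ((2 : ℝ) ^ m.level), ← mul_assoc,
        mul_le_mul_iff_left₀ hM]
      exact_mod_cast Iff.rfl
    rw [h1, h2, add_mul, one_mul]
    have : 1 ≤ 2 ^ i := Nat.one_le_two_pow
    omega
  constructor
  · intro h
    have hlev : m.level ≤ l.level := by
      obtain ⟨h1, h2⟩ := key.1 h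
      rw [add_div] at h2
      rw [add_div] at h2
      have h3 : (1 : ℝ) / 2 ^ l.level ≤ 1 / 2 ^ m.level := by linarith
      rw [one_div_le_one_div (by positivity) (by positivity)] at h3
      exact (pow_le_pow_iff_right₀ (by norm_num : (1 : ℝ) < 2)).1 h3
    obtain ⟨i, hi⟩ := Nat.exists_eq_add_of_le hlev
    exact ⟨i, hi, (shift i hi).1 h⟩
  · rintro ⟨i, hi, h⟩
    exact (shift i hi).2 h

theorem isAnc_iff (m l : Node) :
    m.IsAnc l ↔ ∃ i, l.level = m.level + (i + 1) ∧ l.pos / 2 ^ (i + 1) = m.pos := by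
  unfold IsAnc
  rw [ssubset_iff_subset_not_subset, interval_subset_iff, interval_subset_iff]
  constructor
  · rintro ⟨⟨i, hi, h⟩, h'⟩
    rcases i with _ | i
    · exact absurd ⟨0, by omega, by simpa using h.symm⟩ h'
    · exact ⟨i, hi, h⟩
  · rintro ⟨i, hi, h⟩
    refine ⟨⟨i + 1, hi, h⟩, ?_⟩
    rintro ⟨j, hj, -⟩
    omega

theorem isAncEq_iff (m l : Node) :
    m.IsAncEq l ↔ ∃ i, l.level = m.level + i ∧ l.pos / 2 ^ i = m.pos := by
  unfold IsAncEq
  rw [isAnc_iff]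
  constructor
  · rintro (⟨i, hi, h⟩ | rfl)
    · exact ⟨i + 1, hi, h⟩
    · exact ⟨0, by simp⟩
  · rintro ⟨i, hi, h⟩
    rcases i with _ | i
    · exact Or.inr (Node.ext (by omega) (by simpa using h.symm))
    · exact Or.inl ⟨i, hi, h⟩

theorem isAncEq_iff_subset (m l : Node) : m.IsAncEq l ↔ l.interval ⊆ m.interval := by
  rw [isAncEq_iff, interval_subset_iff]

theorem IsAncEq.refl (l : Node) : l.IsAncEq l := Or.inr rfl

theorem IsAncEq.trans {a b c : Node} (h : a.IsAncEq b) (h' : b.IsAncEq c) : a.IsAncEq c := by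
  rw [isAncEq_iff_subset] at *
  exact h'.trans h

theorem IsAncEq.trans_isAnc {a b c : Node} (h : a.IsAncEq b) (h' : b.IsAnc c) : a.IsAnc c := by
  rw [isAncEq_iff_subset] at h
  exact lt_of_lt_of_le h' h

theorem IsAnc.trans_isAncEq {a b c : Node} (h : a.IsAnc b) (h' : b.IsAncEq c) : a.IsAnc c := by
  rw [isAncEq_iff_subset] at h'
  exact lt_of_le_of_lt h' h

theorem IsAnc.isAncEq {a b : Node} (h : a.IsAnc b) : a.IsAncEq b := Or.inl h

theorem not_isAnc_self (l : Node) : ¬ l.IsAnc l := fun h => (ssubset_irrefl _ h)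

theorem IsAnc.ne {a b : Node} (h : a.IsAnc b) : a ≠ b := by
  rintro rfl
  exact not_isAnc_self _ h

theorem IsAnc.level_lt {a b : Node} (h : a.IsAnc b) : a.level < b.level := by
  obtain ⟨i, hi, -⟩ := (isAnc_iff a b).1 h
  omega

theorem isAnc_left_iff (m l : Node) : m.IsAnc l.left ↔ m.IsAncEq l := by
  rw [isAnc_iff, isAncEq_iff]
  refine exists_congr fun i => ?_
  have : 2 * l.pos / 2 ^ (i + 1) = l.pos / 2 ^ i := by
    rw [pow_succ', Nat.mul_div_mul_left _ _ (by norm_num)]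
  simp only [left, this]
  exact and_congr_left fun _ => by omega

theorem isAnc_right_iff (m l : Node) : m.IsAnc l.right ↔ m.IsAncEq l := by
  rw [isAnc_iff, isAncEq_iff]
  refine exists_congr fun i => ?_
  have : (2 * l.pos + 1) / 2 ^ (i + 1) = l.pos / 2 ^ i := by
    rw [pow_succ', ← Nat.div_div_eq_div_mul]
    congr 1
    omega
  simp only [right, this]
  exact and_congr_left fun _ => by omega

theorem isAncEq_left_iff (m l : Node) : m.IsAncEq l.left ↔ m.IsAncEq l ∨ m = l.left := by
  rw [IsAncEq, isAnc_left_iff]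

theorem isAncEq_right_iff (m l : Node) : m.IsAncEq l.right ↔ m.IsAncEq l ∨ m = l.right := by
  rw [IsAncEq, isAnc_right_iff]

theorem isAnc_left (l : Node) : l.IsAnc l.left := (isAnc_left_iff _ _).2 (.refl _)

theorem isAnc_right (l : Node) : l.IsAnc l.right := (isAnc_right_iff _ _).2 (.refl _)

theorem left_ne_right (l m : Node) : l.left ≠ m.right := by
  intro h
  have := congrArg Node.pos h
  simp only [left, right] at this
  omega

theorem parent_left (l : Node) : l.left.parent = l := by
  ext <;> simp [left, parent]

theorem parent_right (l : Node) : l.right.parent = l := by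
  ext
  · simp [right, parent]
  · simp only [right, parent]
    omega

theorem left_injective : Function.Injective left := fun a b h => by
  rw [← parent_left a, h, parent_left]

theorem right_injective : Function.Injective right := fun a b h => by
  rw [← parent_right a, h, parent_right]

theorem eq_root_of_level_eq_zero {l : Node} (h : l.level = 0) : l = root := by
  have := l.pos_lt
  rw [h] at this
  ext
  · exact h
  · simp only [root]
    omega

theorem eq_left_or_right_parent {l : Node} (h : l.level ≠ 0) :
    l = l.parent.left ∨ l = l.parent.right := by
  rcases Nat.even_or_odd' l.pos with ⟨c, hc | hc⟩
  · left
    ext <;> simp only [left, parent] <;> omega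
  · right
    ext <;> simp only [right, parent] <;> omega

/-- Induction along the dyadic refinement, starting at the root. -/
theorem refinement_induction {motive : Node → Prop} (hroot : motive root)
    (hleft : ∀ l, motive l → motive l.left) (hright : ∀ l, motive l → motive l.right)
    (l : Node) : motive l := by
  induction hn : l.level generalizing l with
  | zero => rwa [eq_root_of_level_eq_zero hn]
  | succ n ih =>
    have hp : motive l.parent := ih _ (by simp [parent, hn])
    rcases eq_left_or_right_parent (l := l) (by omega) with h | h
    · rw [h]
      exact hleft _ hp
    · rw [h]
      exact hright _ hp

theorem not_isAnc_root (l : Node) : ¬ l.IsAnc root := fun h => by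
  have := h.level_lt
  simp [root] at this

theorem isAncEq_root_iff (l : Node) : l.IsAncEq root ↔ l = root := by
  simp [IsAncEq, not_isAnc_root]

theorem root_isAncEq (l : Node) : root.IsAncEq l := by
  induction l using refinement_induction with
  | hroot => exact .refl _
  | hleft l ih => exact (ih.trans_isAnc l.isAnc_left).isAncEq
  | hright l ih => exact (ih.trans_isAnc l.isAnc_right).isAncEq

theorem isAncEq_iff_children (l m : Node) :
    l.IsAncEq m ↔ l = m ∨ l.left.IsAncEq m ∨ l.right.IsAncEq m := by
  constructor
  · induction m using refinement_induction with
    | hroot =>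
      rw [isAncEq_root_iff]
      exact Or.inl
    | hleft m ih =>
      rw [isAncEq_left_iff, isAncEq_left_iff, isAncEq_left_iff]
      rintro (h | h)
      · rcases ih h with rfl | h' | h' <;> tauto
      · exact Or.inl h
    | hright m ih =>
      rw [isAncEq_right_iff, isAncEq_right_iff, isAncEq_right_iff]
      rintro (h | h)
      · rcases ih h with rfl | h' | h' <;> tauto
      · exact Or.inl h
  · rintro (rfl | h | h)
    · exact .refl _
    · exact (l.isAnc_left.trans_isAncEq h).isAncEq
    · exact (l.isAnc_right.trans_isAncEq h).isAncEq

theorem isAnc_iff_children (l m : Node) :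
    l.IsAnc m ↔ l.left.IsAncEq m ∨ l.right.IsAncEq m := by
  constructor
  · intro h
    rcases (isAncEq_iff_children l m).1 h.isAncEq with h' | h'
    · exact absurd h' h.ne
    · exact h'
  · rintro (h | h)
    · exact l.isAnc_left.trans_isAncEq h
    · exact l.isAnc_right.trans_isAncEq h

theorem IsAncEq.eq_of_level_eq {a b m : Node} (ha : a.IsAncEq m) (hb : b.IsAncEq m)
    (h : a.level = b.level) : a = b := by
  obtain ⟨i, hi, ha⟩ := (isAncEq_iff _ _).1 ha
  obtain ⟨j, hj, hb⟩ := (isAncEq_iff _ _).1 hb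
  obtain rfl : i = j := by omega
  exact Node.ext h (ha.symm.trans hb)

theorem not_isAncEq_left_and_right (l m : Node) : ¬ (l.left.IsAncEq m ∧ l.right.IsAncEq m) :=
  fun h => left_ne_right l l (h.1.eq_of_level_eq h.2 rfl)

end Node

/-! ### Trees and their leaves -/

theorem mem_leaves {T : Finset Node} {l : Node} :
    l ∈ leaves T ↔ l ∈ T ∧ ∀ m ∈ T, ¬ l.IsAnc m := by
  simp [leaves]

theorem leaves_subset (T : Finset Node) : leaves T ⊆ T := fun _ h => (mem_leaves.1 h).1

namespace IsTree

variable {T : Finset Node}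

theorem mem_of_isAncEq (hT : IsTree T) {l m : Node} (hm : m.IsAncEq l) (hl : l ∈ T) : m ∈ T := by
  rcases hm with h | rfl
  · exact hT.anc_mem _ hl _ h
  · exact hl

theorem mem_of_left (hT : IsTree T) {l : Node} (h : l.left ∈ T) : l ∈ T :=
  hT.anc_mem _ h _ l.isAnc_left

theorem mem_of_right (hT : IsTree T) {l : Node} (h : l.right ∈ T) : l ∈ T :=
  hT.anc_mem _ h _ l.isAnc_right

theorem left_iff_right (hT : IsTree T) (l : Node) : l.left ∈ T ↔ l.right ∈ T :=
  ⟨fun h => (hT.complete l (hT.mem_of_left h)).1 h,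
    fun h => (hT.complete l (hT.mem_of_right h)).2 h⟩

theorem mem_leaves_iff (hT : IsTree T) {l : Node} : l ∈ leaves T ↔ l ∈ T ∧ l.left ∉ T := by
  rw [mem_leaves]
  refine and_congr_right fun _ => ⟨fun h h' => h _ h' l.isAnc_left, fun h m hm hlm => ?_⟩
  rcases (isAnc_iff_children l m).1 hlm with h' | h'
  · exact h (hT.mem_of_isAncEq h' hm)
  · exact h ((hT.left_iff_right l).2 (hT.mem_of_isAncEq h' hm))

end IsTree

open Classical in
/-- The leaves of `T` that are equal to or descend from `l`. -/
noncomputable def leavesBelow (T : Finset Node) (l : Node) : Finset Node :=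
  (leaves T).filter l.IsAncEq

theorem mem_leavesBelow {T : Finset Node} {l m : Node} :
    m ∈ leavesBelow T l ↔ m ∈ leaves T ∧ l.IsAncEq m := by
  simp [leavesBelow]

theorem leavesBelow_root (T : Finset Node) : leavesBelow T root = leaves T := by
  ext m
  simp [mem_leavesBelow, root_isAncEq]

/-- Descendants of a node below `l` are again below `l`, so cutting `T` down to the nodes below `l`
neither creates nor destroys leaves there. -/
theorem refCount_eq (T : Finset Node) (l : Node) :
    refCount T l = (leavesBelow T l).card - 1 := by
  unfold refCount
  congr 2
  ext m
  simp only [mem_leavesBelow, mem_leaves, Finset.mem_filter]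
  constructor
  · rintro ⟨⟨h1, h2⟩, h3⟩
    exact ⟨⟨h1, fun a ha h => h3 a ⟨ha, h2.trans h.isAncEq⟩ h⟩, h2⟩
  · rintro ⟨⟨h1, h2⟩, h3⟩
    exact ⟨⟨h1, h3⟩, fun a ha h => h2 a ha.1 h⟩

namespace IsTree

variable {T : Finset Node}

theorem leavesBelow_eq_empty (hT : IsTree T) {l : Node} (hl : l ∉ T) : leavesBelow T l = ∅ := by
  refine Finset.eq_empty_of_forall_notMem fun m hm => hl ?_
  rw [mem_leavesBelow] at hm
  exact hT.mem_of_isAncEq hm.2 (leaves_subset T hm.1)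

theorem leavesBelow_leaf {l : Node} (hl : l ∈ leaves T) : leavesBelow T l = {l} := by
  ext m
  rw [mem_leavesBelow, Finset.mem_singleton]
  constructor
  · rintro ⟨h1, h2 | h2⟩
    · exact absurd h2 ((mem_leaves.1 hl).2 m (leaves_subset T h1))
    · exact h2.symm
  · rintro rfl
    exact ⟨hl, .refl _⟩

theorem leavesBelow_inner {l : Node} (hl : l.left ∈ T) :
    leavesBelow T l = leavesBelow T l.left ∪ leavesBelow T l.right := by
  ext m
  simp only [Finset.mem_union, mem_leavesBelow, isAncEq_iff_children l m]
  have : m ∈ leaves T → l ≠ m := by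
    rintro hm rfl
    exact (mem_leaves.1 hm).2 _ hl l.isAnc_left
  tauto

theorem disjoint_leavesBelow (T : Finset Node) (l : Node) :
    Disjoint (leavesBelow T l.left) (leavesBelow T l.right) := by
  rw [Finset.disjoint_left]
  intro m h1 h2
  exact not_isAncEq_left_and_right l m ⟨(mem_leavesBelow.1 h1).2, (mem_leavesBelow.1 h2).2⟩

theorem sum_leavesBelow_inner {M : Type*} [AddCommMonoid M] (g : Node → M) {l : Node}
    (hl : l.left ∈ T) : ∑ m ∈ leavesBelow T l, g m =
      ∑ m ∈ leavesBelow T l.left, g m + ∑ m ∈ leavesBelow T l.right, g m := by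
  rw [leavesBelow_inner hl, Finset.sum_union (disjoint_leavesBelow T l)]

end IsTree

/-- Induction from the finest nodes of a finite set of nodes towards the root. -/
theorem coarsening_induction (T : Finset Node) {motive : Node → Prop}
    (h : ∀ l, (l.left ∈ T → motive l.left) → (l.right ∈ T → motive l.right) → motive l)
    (l : Node) : motive l := by
  induction hn : T.sup Node.level + 1 - l.level using Nat.strong_induction_on generalizing l with
  | _ n ih =>
    refine h l (fun hl => ih _ ?_ _ rfl) (fun hl => ih _ ?_ _ rfl)
    · have := Finset.le_sup (f := Node.level) hl
      simp only [left] at this ⊢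
      omega
    · have := Finset.le_sup (f := Node.level) hl
      simp only [right] at this ⊢
      omega

namespace IsTree

variable {T : Finset Node}

theorem leavesBelow_nonempty (hT : IsTree T) (l : Node) (hl : l ∈ T) :
    (leavesBelow T l).Nonempty := by
  induction l using coarsening_induction T with
  | h l ih1 ih2 =>
    by_cases h : l.left ∈ T
    · rw [leavesBelow_inner h]
      exact (ih1 h h).mono Finset.subset_union_left
    · rw [leavesBelow_leaf (hT.mem_leaves_iff.2 ⟨hl, h⟩)]
      exact Finset.singleton_nonempty _

theorem card_leavesBelow (hT : IsTree T) {l : Node} (hl : l ∈ T) :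
    (leavesBelow T l).card = refCount T l + 1 := by
  have := (hT.leavesBelow_nonempty l hl).card_pos
  rw [refCount_eq]
  omega

theorem refCount_eq_zero (hT : IsTree T) {l : Node} (hl : l.left ∉ T) : refCount T l = 0 := by
  rw [refCount_eq]
  by_cases h : l ∈ T
  · simp [leavesBelow_leaf (hT.mem_leaves_iff.2 ⟨h, hl⟩)]
  · simp [hT.leavesBelow_eq_empty h]

theorem refCount_inner (hT : IsTree T) {l : Node} (hl : l.left ∈ T) :
    refCount T l = refCount T l.left + refCount T l.right + 1 := by
  rw [refCount_eq, leavesBelow_inner hl, Finset.card_union_of_disjoint (disjoint_leavesBelow T l),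
    hT.card_leavesBelow hl, hT.card_leavesBelow ((hT.left_iff_right l).1 hl)]
  omega

/-- On the path from the root to `l`, the last node that still belongs to `T` is a leaf. -/
theorem exists_leaf_isAnc (hT : IsTree T) {l : Node} (hl : l ∉ T) :
    ∃ m ∈ leaves T, m.IsAnc l := by
  induction l using refinement_induction with
  | hroot => exact absurd hT.root_mem hl
  | hleft l ih =>
    by_cases h : l ∈ T
    · exact ⟨l, hT.mem_leaves_iff.2 ⟨h, hl⟩, l.isAnc_left⟩
    · obtain ⟨m, hm, h'⟩ := ih h
      exact ⟨m, hm, h'.trans_isAncEq l.isAnc_left.isAncEq⟩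
  | hright l ih =>
    by_cases h : l ∈ T
    · exact ⟨l, hT.mem_leaves_iff.2 ⟨h, by rwa [hT.left_iff_right]⟩, l.isAnc_right⟩
    · obtain ⟨m, hm, h'⟩ := ih h
      exact ⟨m, hm, h'.trans_isAncEq l.isAnc_right.isAncEq⟩

theorem singleton_root : IsTree {root} where
  root_mem := Finset.mem_singleton_self _
  anc_mem l hl m hm := by
    rw [Finset.mem_singleton.1 hl] at hm
    exact absurd hm (not_isAnc_root m)
  complete l _ := by
    have h1 : l.left ≠ root := fun h => by simpa [left, root] using congrArg Node.level h
    have h2 : l.right ≠ root := fun h => by simpa [right, root] using congrArg Node.level h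
    simp [h1, h2]

/-- Refining a leaf of a tree gives a tree. -/
theorem refine_leaf (hT : IsTree T) {m : Node} (hm : m ∈ leaves T) :
    IsTree (T ∪ {m.left, m.right}) where
  root_mem := Finset.mem_union_left _ hT.root_mem
  anc_mem l hl a ha := by
    refine Finset.mem_union_left _ ?_
    simp only [Finset.mem_union, Finset.mem_insert, Finset.mem_singleton] at hl
    rcases hl with hl | rfl | rfl
    · exact hT.anc_mem _ hl _ ha
    · exact hT.mem_of_isAncEq ((isAnc_left_iff _ _).1 ha) (leaves_subset T hm)
    · exact hT.mem_of_isAncEq ((isAnc_right_iff _ _).1 ha) (leaves_subset T hm)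
  complete l _ := by
    simp [left_injective.eq_iff, right_injective.eq_iff, left_ne_right,
      (left_ne_right _ _).symm, hT.left_iff_right]

theorem leaves_refine (hT : IsTree T) {m : Node} (hm : m ∈ leaves T) (l : Node) :
    l ∈ leaves (T ∪ {m.left, m.right}) ↔ (l ∈ leaves T ∧ l ≠ m) ∨ l = m.left ∨ l = m.right := by
  have hm' := hT.mem_leaves_iff.1 hm
  have hr : m.right ∉ T := by rw [← hT.left_iff_right]; exact hm'.2
  have aux : ∀ a, m.IsAncEq a → a.left ∈ T → False := fun a ha h =>
    (mem_leaves.1 hm).2 _ h ((isAnc_left_iff _ _).2 ha)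
  rw [(hT.refine_leaf hm).mem_leaves_iff, hT.mem_leaves_iff]
  simp only [Finset.mem_union, Finset.mem_insert, Finset.mem_singleton, left_injective.eq_iff,
    left_ne_right, or_false, not_or]
  constructor
  · tauto
  · rintro (h | rfl | rfl)
    · tauto
    · exact ⟨Or.inr (Or.inl rfl), fun h => aux _ m.isAnc_left.isAncEq h, m.isAnc_left.ne.symm⟩
    · exact ⟨Or.inr (Or.inr rfl), fun h => aux _ m.isAnc_right.isAncEq h, m.isAnc_right.ne.symm⟩

-- One leaf is exchanged for two, and only the ancestors of `m` and `m` itself see this exchange.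
open Classical in
theorem refCount_refine (hT : IsTree T) {m : Node} (hm : m ∈ leaves T) (l : Node) :
    refCount (T ∪ {m.left, m.right}) l = refCount T l + if l.IsAncEq m then 1 else 0 := by
  have hm' := hT.mem_leaves_iff.1 hm
  have hr : m.right ∉ T := by rw [← hT.left_iff_right]; exact hm'.2
  split_ifs with h
  · have e : leavesBelow (T ∪ {m.left, m.right}) l =
        insert m.left (insert m.right ((leavesBelow T l).erase m)) := by
      ext a
      simp only [mem_leavesBelow, hT.leaves_refine hm, Finset.mem_insert, Finset.mem_erase]
      have h1 := (h.trans_isAnc m.isAnc_left).isAncEq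
      have h2 := (h.trans_isAnc m.isAnc_right).isAncEq
      constructor
      · tauto
      · rintro (rfl | rfl | h') <;> tauto
    have hlT := hT.mem_of_isAncEq h hm'.1
    have hl2 := hT.card_leavesBelow hlT
    have hmem : m ∈ leavesBelow T l := mem_leavesBelow.2 ⟨hm, h⟩
    rw [refCount_eq, e, Finset.card_insert_of_notMem, Finset.card_insert_of_notMem,
      Finset.card_erase_of_mem hmem]
    · omega
    · exact fun h' => hr (leaves_subset T (mem_leavesBelow.1 (Finset.mem_of_mem_erase h')).1)
    · rw [Finset.mem_insert, not_or]
      exact ⟨left_ne_right _ _, fun h' =>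
        hm'.2 (leaves_subset T (mem_leavesBelow.1 (Finset.mem_of_mem_erase h')).1)⟩
  · by_cases hlT : l ∈ T
    · rw [refCount_eq, refCount_eq, add_zero]
      congr 2
      ext a
      simp only [mem_leavesBelow, hT.leaves_refine hm]
      constructor
      · rintro ⟨h1 | rfl | rfl, h2⟩
        · exact ⟨h1.1, h2⟩
        · rcases (isAncEq_left_iff _ _).1 h2 with h3 | rfl
          · exact absurd h3 h
          · exact absurd hlT hm'.2
        · rcases (isAncEq_right_iff _ _).1 h2 with h3 | rfl
          · exact absurd h3 h
          · exact absurd hlT hr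
      · rintro ⟨h1, h2⟩
        refine ⟨Or.inl ⟨h1, ?_⟩, h2⟩
        rintro rfl
        exact h h2
    -- Outside `T` the old count is the truncated `0 - 1`; a newly created leaf has count `1 - 1`.
    -- So both sides vanish, also for the two new nodes.
    · have h1 : l.left ∉ T := fun h' => hlT (hT.mem_of_left h')
      rw [hT.refCount_eq_zero h1, (hT.refine_leaf hm).refCount_eq_zero]
      intro h'
      simp only [Finset.mem_union, Finset.mem_insert, Finset.mem_singleton,
        left_injective.eq_iff, left_ne_right, or_false] at h'
      rcases h' with h' | rfl
      · exact h1 h'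
      · exact hlT hm'.1

end IsTree

end HaarQuarklet

namespace HaarQuarklet

open Node

/-! ### The harmonic sum -/

theorem harm_nonneg {a b : ℝ} (ha : 0 ≤ a) (hb : 0 ≤ b) : 0 ≤ harm a b := by
  unfold harm
  positivity

theorem harm_pos {a b : ℝ} (ha : 0 < a) (hb : 0 < b) : 0 < harm a b := by
  unfold harm
  positivity

theorem inv_harm {a b : ℝ} (ha : 0 < a) (hb : 0 < b) : (harm a b)⁻¹ = a⁻¹ + b⁻¹ := by
  unfold harm
  field_simp
  ring

/-- For positive values this adds 1/a ≥ 1/x and 1/b ≥ s/x. The product form also covers vanishing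
errors. -/
theorem mul_harm_le {a b s x : ℝ} (ha : 0 ≤ a) (hb : 0 ≤ b) (hx : 0 ≤ x) (hax : a ≤ x)
    (hbx : s * b ≤ x) : (s + 1) * harm a b ≤ x := by
  rcases (add_nonneg ha hb).eq_or_lt with h | h
  · rw [harm, ← h, div_zero, mul_zero]
    exact hx
  · rw [harm, ← mul_div_assoc, div_le_iff₀ h]
    nlinarith [mul_le_mul_of_nonneg_right hbx ha, mul_le_mul_of_nonneg_right hax hb]

theorem harm_le_left {a b : ℝ} (ha : 0 ≤ a) (hb : 0 ≤ b) : harm a b ≤ a := by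
  simpa using mul_harm_le (s := 0) ha hb ha le_rfl (by simpa using ha)

theorem harm_le_right {a b : ℝ} (ha : 0 ≤ a) (hb : 0 ≤ b) : harm a b ≤ b := by
  have : harm a b = harm b a := by rw [harm, harm, mul_comm, add_comm]
  rw [this]
  exact harm_le_left hb ha

/-! ### Local error functionals -/

/-- Local errors are nonnegative, decreasing in the degree and, for degree `0`, subadditive under
refinement. -/
structure IsLocalError (e : ℕ → Node → ℝ) : Prop where
  nonneg : ∀ p l, 0 ≤ e p l
  anti : ∀ l, Antitone fun p => e p l
  children_le : ∀ l : Node, e 0 l.left + e 0 l.right ≤ e 0 l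

variable {e : ℕ → Node → ℝ}

theorem modErr_root : modErr e root = e 0 root := by
  rw [modErr, dif_pos (show root.level = 0 from rfl)]

theorem modErr_left (l : Node) : modErr e l.left = harm (e 0 l.left) (modErr e l) := by
  rw [modErr, dif_neg (by simp [left]), parent_left]

theorem modErr_right (l : Node) : modErr e l.right = harm (e 0 l.right) (modErr e l) := by
  rw [modErr, dif_neg (by simp [right]), parent_right]

theorem treeErr_inner {T : Finset Node} (hT : IsTree T) {l : Node} (hl : l.left ∈ T) :
    treeErr e T l = min (treeErr e T l.left + treeErr e T l.right) (e (refCount T l) l) := by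
  rw [treeErr, dif_pos ⟨hl, (hT.left_iff_right l).1 hl⟩]

theorem treeErr_outer {T : Finset Node} {l : Node} (hl : l.left ∉ T) :
    treeErr e T l = e 0 l := by
  rw [treeErr, dif_neg fun h => hl h.1]

theorem treeErr_le {T : Finset Node} (hT : IsTree T) (l : Node) :
    treeErr e T l ≤ e (refCount T l) l := by
  by_cases h : l.left ∈ T
  · rw [treeErr_inner hT h]
    exact min_le_right _ _
  · rw [treeErr_outer h, hT.refCount_eq_zero h]

namespace IsLocalError

theorem left_le (he : IsLocalError e) (l : Node) : e 0 l.left ≤ e 0 l := by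
  linarith [he.children_le l, he.nonneg 0 l.right]

theorem right_le (he : IsLocalError e) (l : Node) : e 0 l.right ≤ e 0 l := by
  linarith [he.children_le l, he.nonneg 0 l.left]

theorem modErr_nonneg (he : IsLocalError e) (l : Node) : 0 ≤ modErr e l := by
  induction l using refinement_induction with
  | hroot => rw [modErr_root]; exact he.nonneg _ _
  | hleft l ih => rw [modErr_left]; exact harm_nonneg (he.nonneg _ _) ih
  | hright l ih => rw [modErr_right]; exact harm_nonneg (he.nonneg _ _) ih

theorem modErr_pos (he : IsLocalError e) (l : Node) (hl : 0 < e 0 l) : 0 < modErr e l := by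
  induction l using refinement_induction with
  | hroot => rwa [modErr_root]
  | hleft l ih => rw [modErr_left]; exact harm_pos hl (ih (hl.trans_le (he.left_le l)))
  | hright l ih => rw [modErr_right]; exact harm_pos hl (ih (hl.trans_le (he.right_le l)))

theorem modErr_le (he : IsLocalError e) (l : Node) : modErr e l ≤ e 0 l := by
  cases l using refinement_induction with
  | hroot => rw [modErr_root]
  | hleft l _ => rw [modErr_left]; exact harm_le_left (he.nonneg _ _) (he.modErr_nonneg l)
  | hright l _ => rw [modErr_right]; exact harm_le_left (he.nonneg _ _) (he.modErr_nonneg l)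

variable {T : Finset Node}

theorem treeErr_nonneg (he : IsLocalError e) (hT : IsTree T) (l : Node) : 0 ≤ treeErr e T l := by
  induction l using coarsening_induction T with
  | h l ih1 ih2 =>
    by_cases h : l.left ∈ T
    · rw [treeErr_inner hT h]
      exact le_min (add_nonneg (ih1 h) (ih2 ((hT.left_iff_right l).1 h))) (he.nonneg _ _)
    · rw [treeErr_outer h]
      exact he.nonneg _ _

theorem treeErr_le_zero (he : IsLocalError e) (hT : IsTree T) (l : Node) :
    treeErr e T l ≤ e 0 l :=
  (treeErr_le hT l).trans (he.anti l (Nat.zero_le _))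

/-- Enlarging the tree raises the admissible degree at inner nodes and splits leaves; antitonicity
and subadditivity show that neither increases the functional. -/
theorem treeErr_anti (he : IsLocalError e) {T' : Finset Node} (hT : IsTree T) (hT' : IsTree T')
    (hsub : T ⊆ T') (href : ∀ l, refCount T l ≤ refCount T' l) (l : Node) :
    treeErr e T' l ≤ treeErr e T l := by
  induction l using coarsening_induction T' with
  | h l ih1 ih2 =>
    by_cases h' : l.left ∈ T'
    · have h'' := (hT'.left_iff_right l).1 h'
      rw [treeErr_inner hT' h']
      by_cases h : l.left ∈ T
      · rw [treeErr_inner hT h]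
        exact min_le_min (add_le_add (ih1 h') (ih2 h'')) (he.anti l (href l))
      · rw [treeErr_outer h]
        exact (min_le_left _ _).trans ((add_le_add (he.treeErr_le_zero hT' _)
          (he.treeErr_le_zero hT' _)).trans (he.children_le l))
    · rw [treeErr_outer h', treeErr_outer fun h => h' (hsub h)]

end IsLocalError

/-! ### Runs of the algorithm -/

theorem thr_inner {S : ℕ → Finset Node} {k : ℕ} (hT : IsTree (S k)) {l : Node}
    (hl : l.left ∈ S k) :
    thr e S k l = min (max (thr e S k l.left) (thr e S k l.right)) (penErr e S k l) := by
  rw [thr, dif_pos ⟨hl, (hT.left_iff_right l).1 hl⟩]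

theorem thr_outer {S : ℕ → Finset Node} {k : ℕ} {l : Node} (hl : l.left ∉ S k) :
    thr e S k l = modErr e l := by
  rw [thr, dif_neg fun h => hl h.1]

/-- The leaf selected by the algorithm descends from `l`, and `q` does not fall below `q l` on the
path from `l` to that leaf. -/
theorem PointsTo.spec {q : Node → ℝ} {T : Finset Node} {l m : Node} (h : PointsTo q T l m)
    (hq : ∀ l : Node, l.left ∈ T ∨ l.right ∈ T → q l ≤ max (q l.left) (q l.right)) :
    m ∈ leaves T ∧ l.IsAncEq m ∧ ∀ a, l.IsAncEq a → a.IsAncEq m → q l ≤ q a := by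
  induction h with
  | leaf l hl =>
    refine ⟨hl, .refl _, fun a h1 h2 => ?_⟩
    rcases h1 with h1 | rfl
    · exact absurd (h1.trans_isAncEq h2) (not_isAnc_self l)
    · exact le_rfl
  | left l m hl hle _ ih =>
    obtain ⟨hm, hlm, hpath⟩ := ih
    refine ⟨hm, (l.isAnc_left.trans_isAncEq hlm).isAncEq, fun a h1 h2 => ?_⟩
    rcases (isAncEq_iff_children l a).1 h1 with rfl | h3 | h3
    · exact le_rfl
    · have := hq l (Or.inl hl)
      rw [max_eq_left hle] at this
      exact this.trans (hpath a h3 h2)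
    · exact absurd ⟨hlm, h3.trans h2⟩ (not_isAncEq_left_and_right l m)
  | right l m hl hle _ ih =>
    obtain ⟨hm, hlm, hpath⟩ := ih
    refine ⟨hm, (l.isAnc_right.trans_isAncEq hlm).isAncEq, fun a h1 h2 => ?_⟩
    rcases (isAncEq_iff_children l a).1 h1 with rfl | h3 | h3
    · exact le_rfl
    · exact absurd ⟨h3.trans h2, hlm⟩ (not_isAncEq_left_and_right l m)
    · have := hq l (Or.inr hl)
      rw [max_eq_right hle] at this
      exact this.trans (hpath a h3 h2)

variable {S : ℕ → Finset Node} {N : ℕ}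

theorem IsRun.step_of_isTree (hS : IsRun e S N) {k : ℕ} (hk : k < N) (hT : IsTree (S k)) :
    ∃ m ∈ leaves (S k), S (k + 1) = S k ∪ {m.left, m.right} ∧
      ∀ a, a.IsAncEq m → thr e S k root ≤ thr e S k a := by
  obtain ⟨m, hm, hSk⟩ := hS.2 k hk
  have := hm.spec (fun l hl => by
    have hl' : l.left ∈ S k := by rwa [← hT.left_iff_right, or_self] at hl
    rw [thr_inner hT hl']
    exact min_le_left _ _)
  exact ⟨m, this.1, hSk, fun a ha => this.2.2 a (root_isAncEq a) ha⟩

theorem IsRun.isTree (hS : IsRun e S N) : ∀ k ≤ N, IsTree (S k) := by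
  intro k
  induction k with
  | zero => exact fun _ => hS.1 ▸ IsTree.singleton_root
  | succ k ih =>
    intro hk
    have hT := ih (by omega)
    obtain ⟨m, hm, hSk, -⟩ := hS.step_of_isTree (by omega : k < N) hT
    rw [hSk]
    exact hT.refine_leaf hm

theorem IsRun.step (hS : IsRun e S N) {k : ℕ} (hk : k < N) :
    ∃ m ∈ leaves (S k), S (k + 1) = S k ∪ {m.left, m.right} ∧
      ∀ a, a.IsAncEq m → thr e S k root ≤ thr e S k a :=
  hS.step_of_isTree hk (hS.isTree k hk.le)

theorem IsRun.mono (hS : IsRun e S N) {k : ℕ} (hk : k < N) : S k ⊆ S (k + 1) := by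
  obtain ⟨m, -, h, -⟩ := hS.step hk
  rw [h]
  exact Finset.subset_union_left

/-- In one step either `r(l)` is unchanged, or `r(l)` grows by one and `q(root) ≤ q(l)`. -/
theorem IsRun.refCount_step (hS : IsRun e S N) {k : ℕ} (hk : k < N) (l : Node) :
    refCount (S (k + 1)) l = refCount (S k) l ∨
      refCount (S (k + 1)) l = refCount (S k) l + 1 ∧ thr e S k root ≤ thr e S k l := by
  obtain ⟨m, hm, h, hpath⟩ := hS.step hk
  rw [h, (hS.isTree k hk.le).refCount_refine hm]
  split_ifs with hl
  · exact Or.inr ⟨rfl, hpath l hl⟩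
  · exact Or.inl rfl

theorem IsRun.refCount_le_succ (hS : IsRun e S N) {k : ℕ} (hk : k < N) (l : Node) :
    refCount (S k) l ≤ refCount (S (k + 1)) l := by
  rcases hS.refCount_step hk l with h | ⟨h, -⟩ <;> omega

theorem IsRun.refCount_zero (hS : IsRun e S N) (l : Node) : refCount (S 0) l = 0 := by
  rw [hS.1]
  exact IsTree.singleton_root.refCount_eq_zero fun h => by
    simpa [left, root] using congrArg Node.level (Finset.mem_singleton.1 h)

theorem IsRun.refCount_root (hS : IsRun e S N) : ∀ k ≤ N, refCount (S k) root = k := by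
  intro k
  induction k with
  | zero => exact fun _ => hS.refCount_zero root
  | succ k ih =>
    intro hk
    have hk' : k < N := by omega
    obtain ⟨m, hm, h, -⟩ := hS.step hk'
    rw [h, (hS.isTree k hk'.le).refCount_refine hm, if_pos (root_isAncEq m), ih hk'.le]

theorem IsRun.card_le (hS : IsRun e S N) : ∀ k ≤ N, (S k).card ≤ 2 * k + 1 := by
  intro k
  induction k with
  | zero => simp [hS.1]
  | succ k ih =>
    intro hk
    obtain ⟨m, -, h, -⟩ := hS.step (show k < N by omega)
    have h1 := Finset.card_union_le (S k) {m.left, m.right}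
    have h2 := Finset.card_le_two (a := m.left) (b := m.right)
    have h3 := ih (by omega)
    rw [h]
    omega

/-- Counts never decrease along a run, so a zero count means that no update has taken place yet. -/
theorem IsRun.penErr_eq_modErr (hS : IsRun e S N) (l : Node) :
    ∀ k ≤ N, refCount (S k) l = 0 → penErr e S k l = modErr e l := by
  intro k
  induction k with
  | zero => exact fun _ _ => rfl
  | succ k ih =>
    intro hk h0
    have h1 := hS.refCount_le_succ (show k < N by omega) l
    rw [penErr, if_pos (by omega)]
    exact ih (by omega) (by omega)

theorem IsRun.thr_le_penErr (hS : IsRun e S N) {k : ℕ} (hk : k ≤ N) (l : Node) :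
    thr e S k l ≤ penErr e S k l := by
  have hT := hS.isTree k hk
  by_cases h : l.left ∈ S k
  · rw [thr_inner hT h]
    exact min_le_right _ _
  · rw [thr_outer h, hS.penErr_eq_modErr l k hk (hT.refCount_eq_zero h)]

/-! ### Monotonicity in time and two-sided bounds by the threshold at the root -/

namespace IsLocalError

theorem treeErr_succ_le (he : IsLocalError e) (hS : IsRun e S N) {k : ℕ} (hk : k < N) (l : Node) :
    treeErr e (S (k + 1)) l ≤ treeErr e (S k) l :=
  he.treeErr_anti (hS.isTree k hk.le) (hS.isTree _ hk) (hS.mono hk) (hS.refCount_le_succ hk) l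

theorem penErr_nonneg (he : IsLocalError e) (hS : IsRun e S N) (l : Node) :
    ∀ k ≤ N, 0 ≤ penErr e S k l := by
  intro k
  induction k with
  | zero => exact fun _ => he.modErr_nonneg l
  | succ k ih =>
    intro hk
    rw [penErr]
    split_ifs
    · exact ih (by omega)
    · exact harm_nonneg (he.treeErr_nonneg (hS.isTree _ hk) l) (ih (by omega))

theorem penErr_succ_le (he : IsLocalError e) (hS : IsRun e S N) {k : ℕ} (hk : k < N) (l : Node) :
    penErr e S (k + 1) l ≤ penErr e S k l := by
  rw [penErr]
  split_ifs
  · exact le_rfl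
  · exact harm_le_right (he.treeErr_nonneg (hS.isTree _ hk) l) (he.penErr_nonneg hS l k hk.le)

theorem thr_nonneg (he : IsLocalError e) (hS : IsRun e S N) {k : ℕ} (hk : k ≤ N) (l : Node) :
    0 ≤ thr e S k l := by
  have hT := hS.isTree k hk
  induction l using coarsening_induction (S k) with
  | h l ih1 ih2 =>
    by_cases h : l.left ∈ S k
    · rw [thr_inner hT h]
      exact le_min ((ih1 h).trans (le_max_left _ _)) (he.penErr_nonneg hS l k hk)
    · rw [thr_outer h]
      exact he.modErr_nonneg l

theorem thr_succ_le (he : IsLocalError e) (hS : IsRun e S N) {k : ℕ} (hk : k < N) (l : Node) :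
    thr e S (k + 1) l ≤ thr e S k l := by
  have hT := hS.isTree k hk.le
  have hT' := hS.isTree (k + 1) hk
  induction l using coarsening_induction (S (k + 1)) with
  | h l ih1 ih2 =>
    by_cases h' : l.left ∈ S (k + 1)
    · have h'' := (hT'.left_iff_right l).1 h'
      rw [thr_inner hT' h']
      have hpen := he.penErr_succ_le hS hk l
      by_cases h : l.left ∈ S k
      · rw [thr_inner hT h]
        exact min_le_min (max_le_max (ih1 h') (ih2 h'')) hpen
      -- A leaf that has just been split: its new value is capped by the penalised error, which
      -- started at `modErr` and only decreases.
      · rw [thr_outer h]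
        rw [hS.penErr_eq_modErr l k hk.le (hT.refCount_eq_zero h)] at hpen
        exact (min_le_right _ _).trans hpen
    · rw [thr_outer h', thr_outer fun h => h' (hS.mono hk h)]

theorem thr_anti (he : IsLocalError e) (hS : IsRun e S N) (l : Node) {k k' : ℕ} (h : k ≤ k')
    (hk' : k' ≤ N) : thr e S k' l ≤ thr e S k l := by
  induction k', h using Nat.le_induction with
  | base => exact le_rfl
  | succ k' _ ih => exact (he.thr_succ_le hS (by omega) l).trans (ih (by omega))

/-- The penalised error controls the local errors from below. -/
theorem mul_penErr_le (he : IsLocalError e) (hS : IsRun e S N) (l : Node) :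
    ∀ k ≤ N, ∀ p ≤ refCount (S k) l,
      ((refCount (S k) l : ℝ) - p + 1) * penErr e S k l ≤ e p l := by
  intro k
  induction k with
  | zero =>
    intro _ p hp
    rw [hS.refCount_zero] at hp ⊢
    obtain rfl : p = 0 := by omega
    simpa [penErr] using he.modErr_le l
  | succ k ih =>
    intro hk p hp
    have hk' : k < N := by omega
    have hT := hS.isTree _ hk
    rw [penErr]
    rcases hS.refCount_step hk' l with h | ⟨h, -⟩
    · rw [if_pos h, h]
      exact ih hk'.le p (h ▸ hp)
    · rw [if_neg (by omega), h]
      have hE : treeErr e (S (k + 1)) l ≤ e p l := (treeErr_le hT l).trans (he.anti l hp)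
      refine mul_harm_le (he.treeErr_nonneg hT l) (he.penErr_nonneg hS l k hk'.le)
        (he.nonneg _ _) hE ?_
      -- For `p` equal to the new count the induction hypothesis says nothing, but then the factor
      -- in front of the old penalised error is zero.
      rcases hp.eq_or_lt with hp' | hp'
      · rw [hp', h]
        simpa using he.nonneg _ _
      · have := ih hk'.le p (by omega)
        push_cast
        convert this using 2
        ring

/-- Local errors are bounded from below by the final threshold `q(root)`. -/
theorem mul_thr_le (he : IsLocalError e) (hS : IsRun e S N) (l : Node) (p : ℕ) :
    ∀ k ≤ N, ((refCount (S k) l : ℝ) - p) * thr e S N root ≤ e p l := by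
  have ht := he.thr_nonneg hS le_rfl root
  intro k
  induction k with
  | zero =>
    intro _
    rw [hS.refCount_zero]
    have hp : (0 : ℝ) ≤ p := p.cast_nonneg
    push_cast
    nlinarith [he.nonneg p l]
  | succ k ih =>
    intro hk
    have hk' : k < N := by omega
    rcases hS.refCount_step hk' l with h | ⟨h, hthr⟩
    · rw [h]
      exact ih hk'.le
    · rw [h]
      by_cases hp : p ≤ refCount (S k) l
      · refine le_trans ?_ (he.mul_penErr_le hS l k hk'.le p hp)
        have h1 : thr e S N root ≤ penErr e S k l :=
          ((he.thr_anti hS root hk'.le le_rfl).trans hthr).trans (hS.thr_le_penErr hk'.le l)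
        have h2 : (p : ℝ) ≤ refCount (S k) l := by exact_mod_cast hp
        push_cast
        nlinarith
      · have h2 : ((refCount (S k) l + 1 : ℕ) : ℝ) ≤ p := by
          exact_mod_cast (by omega : refCount (S k) l + 1 ≤ p)
        nlinarith [he.nonneg p l]

/-- The penalised error controls the tree error from above. -/
theorem treeErr_le_penErr_mul (he : IsLocalError e) (hS : IsRun e S N) (l : Node) :
    ∀ k ≤ N, ∀ x, 0 < x → x ≤ treeErr e (S k) l →
      x ≤ penErr e S k l * (refCount (S k) l + x / modErr e l) := by
  intro k
  induction k with
  | zero =>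
    intro hk x hx hxE
    have := he.modErr_pos l (hx.trans_le (hxE.trans (he.treeErr_le_zero (hS.isTree 0 hk) l)))
    rw [hS.refCount_zero, penErr]
    push_cast
    rw [zero_add, mul_div_cancel₀ _ this.ne']
  | succ k ih =>
    intro hk x hx hxE
    have hk' : k < N := by omega
    have hE := he.treeErr_succ_le hS hk' l
    rw [penErr]
    rcases hS.refCount_step hk' l with h | ⟨h, -⟩
    · rw [if_pos h, h]
      exact ih hk'.le x hx (hxE.trans hE)
    · rw [if_neg (by omega), h]
      set E := treeErr e (S (k + 1)) l
      have hE0 : 0 < E := hx.trans_le hxE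
      have hM := he.modErr_pos l (hE0.trans_le (he.treeErr_le_zero (hS.isTree _ hk) l))
      -- Quantifying over all `x` up to the tree error pays off here: the old estimate is applied to
      -- the new, smaller error `E`.
      have hI := ih hk'.le E hE0 hE
      set P := penErr e S k l
      set r := (refCount (S k) l : ℝ)
      have hP : 0 ≤ P := he.penErr_nonneg hS l k hk'.le
      have hr : 0 ≤ r := Nat.cast_nonneg _
      have h1 : E ≤ harm E P * (r + 1 + E / modErr e l) := by
        rw [harm, div_mul_eq_mul_div, le_div_iff₀ (by positivity)]
        nlinarith [mul_le_mul_of_nonneg_left hI hE0.le]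
      have hH : 0 ≤ harm E P := harm_nonneg hE0.le hP
      -- Passing from `E` to `x ≤ E`: after division, the right side of `h1` is `harm E P` times (r
      -- + 1)/E + 1/ẽ, which grows when `E` is replaced by `x`.
      have h2 : x * E ≤ E * (harm E P * (r + 1 + x / modErr e l)) := by
        have h3 : x * E ≤ x * (harm E P * (r + 1 + E / modErr e l)) :=
          mul_le_mul_of_nonneg_left h1 hx.le
        refine h3.trans (le_of_sub_nonneg ?_)
        have : E * (harm E P * (r + 1 + x / modErr e l)) -
            x * (harm E P * (r + 1 + E / modErr e l)) = (E - x) * (harm E P * (r + 1)) := by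
          field_simp
          ring
        rw [this]
        exact mul_nonneg (by linarith) (by positivity)
      push_cast
      nlinarith

/-- If `q(l) ≤ t`, then either the penalised error at `l` is at most `t` or both children have `q ≤
t`; so the recursion stops at nodes of the first kind. The witness `x` is the sum of the tree errors
at these nodes. Unlike the tree error, which involves minima, it is exactly additive over siblings.
-/
theorem treeErr_bound_aux (he : IsLocalError e) (hS : IsRun e S N) {t : ℝ} (ht : 0 ≤ t) (l : Node)
    (hl : thr e S N l ≤ t) : ∃ x, treeErr e (S N) l ≤ x ∧ 0 ≤ x ∧ x ≤ e 0 l ∧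
      x ≤ t * (2 * refCount (S N) l + x / modErr e l) := by
  have hT := hS.isTree N le_rfl
  have terminal : ∀ l, penErr e S N l ≤ t → ∃ x, treeErr e (S N) l ≤ x ∧ 0 ≤ x ∧ x ≤ e 0 l ∧
      x ≤ t * (2 * refCount (S N) l + x / modErr e l) := by
    intro l hl
    have hE := he.treeErr_nonneg hT l
    have hM := he.modErr_nonneg l
    refine ⟨_, le_rfl, hE, he.treeErr_le_zero hT l, ?_⟩
    rcases hE.eq_or_lt with h0 | h0
    · rw [← h0]
      positivity
    · refine (he.treeErr_le_penErr_mul hS l N le_rfl _ h0 le_rfl).trans ?_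
      gcongr
      have : (0 : ℝ) ≤ refCount (S N) l := Nat.cast_nonneg _
      linarith
  -- Moving from a child to its parent costs at most one unit: x/ẽ(a) = x/e_0(a) + x/ẽ(l), and x ≤
  -- e_0(a).
  have lift : ∀ a l : Node, modErr e a = harm (e 0 a) (modErr e l) → e 0 a ≤ e 0 l →
      ∀ x r : ℝ, 0 ≤ r → 0 ≤ x → x ≤ e 0 a → x ≤ t * (r + x / modErr e a) →
        x ≤ t * (r + 1 + x / modErr e l) := by
    intro a l ha hal x r hr hx hxa hxt
    rcases hx.eq_or_lt with rfl | h0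
    · rw [zero_div]
      positivity
    · have ha0 := h0.trans_le hxa
      have hl0 := he.modErr_pos l (ha0.trans_le hal)
      refine hxt.trans (mul_le_mul_of_nonneg_left ?_ ht)
      rw [ha, div_eq_mul_inv, inv_harm ha0 hl0, mul_add, ← div_eq_mul_inv, ← div_eq_mul_inv]
      have : x / e 0 a ≤ 1 := (div_le_one ha0).2 hxa
      linarith
  induction l using coarsening_induction (S N) with
  | h l ih1 ih2 =>
    by_cases h : l.left ∈ S N
    · have h' := (hT.left_iff_right l).1 h
      rw [thr_inner hT h, min_le_iff, max_le_iff] at hl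
      rcases hl with ⟨hl1, hl2⟩ | hl
      · obtain ⟨x, hx1, hx2, hx3, hx4⟩ := ih1 h hl1
        obtain ⟨y, hy1, hy2, hy3, hy4⟩ := ih2 h' hl2
        have hx := lift _ l (modErr_left l) (he.left_le l) x _ (by positivity) hx2 hx3 hx4
        have hy := lift _ l (modErr_right l) (he.right_le l) y _ (by positivity) hy2 hy3 hy4
        refine ⟨x + y, ?_, by positivity, by linarith [he.children_le l], ?_⟩
        · rw [treeErr_inner hT h]
          exact (min_le_left _ _).trans (add_le_add hx1 hy1)
        -- The two units lost at the children are absorbed by `2 r(l) = 2 r(left) + 2 r(right) + 2`;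
        -- this is the origin of the factor 2.
        · rw [hT.refCount_inner h, add_div]
          push_cast
          linarith
      · exact terminal l hl
    · rw [thr_outer h, ← hS.penErr_eq_modErr l N le_rfl (hT.refCount_eq_zero h)] at hl
      exact terminal l hl

theorem treeErr_root_le (he : IsLocalError e) (hS : IsRun e S N) :
    treeErr e (S N) root ≤ (2 * N + 1) * thr e S N root := by
  have ht := he.thr_nonneg hS le_rfl root
  obtain ⟨x, h1, h2, h3, h4⟩ := he.treeErr_bound_aux hS ht root le_rfl
  rw [modErr_root, hS.refCount_root N le_rfl] at h4
  have : x / e 0 root ≤ 1 := div_le_one_of_le₀ h3 (he.nonneg _ _)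
  nlinarith [mul_le_mul_of_nonneg_left this ht]

end IsLocalError

/-! ### Comparison with quarklet trees -/

/-- The leaves of a tree `T'` capture all but `|𝒱(T')| - 1` of the refinements of a tree `T`. -/
theorem IsTree.refCount_add_one_le_sum {T T' : Finset Node} (hT : IsTree T) (hT' : IsTree T')
    (l : Node) (hl : l ∈ T') :
    refCount T l + 1 ≤ ∑ m ∈ leavesBelow T' l, (refCount T m + 1) := by
  induction l using coarsening_induction T' with
  | h l ih1 ih2 =>
    by_cases h : l.left ∈ T'
    · have h' := (hT'.left_iff_right l).1 h
      rw [sum_leavesBelow_inner _ h]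
      have h1 := ih1 h h
      have h2 := ih2 h' h'
      have h3 : refCount T l ≤ refCount T l.left + refCount T l.right + 1 := by
        by_cases hh : l.left ∈ T
        · exact (hT.refCount_inner hh).le
        · rw [hT.refCount_eq_zero hh]
          omega
      omega
    · rw [leavesBelow_leaf (hT'.mem_leaves_iff.2 ⟨hl, h⟩), Finset.sum_singleton]

variable {top : Node → Node}

theorem le_pmax {T : Finset Node} (P : Node → ℕ) {l m : Node} (hl : l ∈ leaves T)
    (hm : m ∈ Ups top l) : P l ≤ pmax top T P m := by
  unfold pmax
  exact Finset.le_sup (f := P) (by simp [hl, hm])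

theorem IsEnrichment.mem_ups_self (htop : IsEnrichment top) (l : Node) : l ∈ Ups top l :=
  ⟨.refl _, htop.top_ancEq l⟩

/-- Every leaf lies in its own enrichment set, so its degree is already paid for at the leaf; the
cost at inner nodes is discarded. -/
theorem IsEnrichment.sum_leaves_le_qcard (htop : IsEnrichment top) (T : Finset Node)
    (P : Node → ℕ) : ∑ l ∈ leaves T, (P l + 1) ≤ qcard top T P := by
  rw [Finset.sum_add_distrib, qcard, add_comm, Finset.sum_const, smul_eq_mul, mul_one]
  refine add_le_add (Finset.card_le_card (leaves_subset T)) ?_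
  refine (Finset.sum_le_sum fun l hl => le_pmax P hl (htop.mem_ups_self l)).trans ?_
  exact Finset.sum_le_sum_of_subset (leaves_subset T)

theorem IsLocalError.mul_thr_le_bestErr (he : IsLocalError e) (hS : IsRun e S N)
    (htop : IsEnrichment top) {n : ℕ} (hn : 1 ≤ n) :
    ((N : ℝ) - n + 1) * thr e S N root ≤ bestErr top e n := by
  have ht := he.thr_nonneg hS le_rfl root
  refine le_csInf ?_ ?_
  -- The infimum needs a competitor: the root with degree 0 has cardinality 1, which is where `1 ≤
  -- n` enters.
  · refine ⟨_, {root}, fun _ => 0, IsTree.singleton_root, ?_, rfl⟩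
    have : ∀ m, pmax top {root} (fun _ => 0) m = 0 := fun m => by simp [pmax]
    simpa [qcard, this] using hn
  · rintro x ⟨T, P, hT, hcard, rfl⟩
    have h1 := (hS.isTree N le_rfl).refCount_add_one_le_sum hT root hT.root_mem
    rw [hS.refCount_root N le_rfl, leavesBelow_root] at h1
    have h2 := (htop.sum_leaves_le_qcard T P).trans hcard
    have h3 : (N : ℝ) - n + 1 ≤ ∑ l ∈ leaves T, ((refCount (S N) l : ℝ) - P l) := by
      have h1' : ((N + 1 : ℕ) : ℝ) ≤ ((∑ m ∈ leaves T, (refCount (S N) m + 1) : ℕ) : ℝ) := by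
        exact_mod_cast h1
      have h2' : ((∑ l ∈ leaves T, (P l + 1) : ℕ) : ℝ) ≤ n := by exact_mod_cast h2
      push_cast [Finset.sum_add_distrib] at h1' h2'
      rw [Finset.sum_sub_distrib]
      linarith
    calc ((N : ℝ) - n + 1) * thr e S N root
        ≤ (∑ l ∈ leaves T, ((refCount (S N) l : ℝ) - P l)) * thr e S N root := by gcongr
      _ ≤ globalErr e T P := by
        rw [Finset.sum_mul, globalErr]
        exact Finset.sum_le_sum fun l _ => he.mul_thr_le hS l (P l) N le_rfl

/-! ### Trimming -/

theorem mem_trim {T : Finset Node} {l : Node} :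
    l ∈ trim e T ↔ l ∈ T ∧ ∀ m ∈ T, m.IsAnc l → treeErr e T m ≠ e (refCount T m) m := by
  simp [trim]

theorem IsTree.trim {T : Finset Node} (hT : IsTree T) (e : ℕ → Node → ℝ) :
    IsTree (trim e T) where
  root_mem := mem_trim.2 ⟨hT.root_mem, fun m _ h => absurd h (not_isAnc_root m)⟩
  anc_mem l hl m hm := by
    rw [mem_trim] at hl ⊢
    exact ⟨hT.anc_mem _ hl.1 _ hm, fun a ha h => hl.2 a ha (h.trans_isAncEq hm.isAncEq)⟩
  complete l _ := by
    simp only [mem_trim, hT.left_iff_right, isAnc_left_iff, isAnc_right_iff]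

/-- At an inner node of the trimmed tree the minimum is attained by the sum over the children, so
the recursion unrolls down to the new leaves, where the tree error equals the local error. -/
theorem globalErr_trim_le {T : Finset Node} (hT : IsTree T) :
    globalErr e (trim e T) (refCount T) ≤ treeErr e T root := by
  have hT' := hT.trim e
  have key : ∀ l, l ∈ trim e T →
      ∑ m ∈ leavesBelow (trim e T) l, e (refCount T m) m ≤ treeErr e T l := by
    intro l
    induction l using coarsening_induction (trim e T) with
    | h l ih1 ih2 =>
      intro hl
      by_cases h : l.left ∈ trim e T
      · have h' := (hT'.left_iff_right l).1 h
        have hne := (mem_trim.1 h).2 l (mem_trim.1 hl).1 l.isAnc_left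
        have hlT := (mem_trim.1 h).1
        rw [IsTree.sum_leavesBelow_inner _ h]
        rw [treeErr_inner hT hlT] at hne ⊢
        rcases min_choice (treeErr e T l.left + treeErr e T l.right) (e (refCount T l) l) with
          hmin | hmin
        · rw [hmin]
          exact add_le_add (ih1 h h) (ih2 h' h')
        · exact absurd hmin hne
      · rw [IsTree.leavesBelow_leaf (hT'.mem_leaves_iff.2 ⟨hl, h⟩), Finset.sum_singleton]
        by_cases hlT : l.left ∈ T
        -- The children were trimmed because of a node weakly above `l`. A node strictly above would
        -- have removed `l` too, so it is `l` itself.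
        · rw [mem_trim, not_and] at h
          have := h hlT
          push Not at this
          obtain ⟨m, hm, hml, heq⟩ := this
          rcases (isAnc_left_iff _ _).1 hml with h1 | rfl
          · exact absurd heq ((mem_trim.1 hl).2 m hm h1)
          · exact heq.ge
        · rw [treeErr_outer hlT, hT.refCount_eq_zero hlT]
  rw [globalErr, ← leavesBelow_root]
  exact key root hT'.root_mem

theorem IsLocalError.globalErr_trim_le (he : IsLocalError e) (hS : IsRun e S N)
    (htop : IsEnrichment top) {n : ℕ} (hn : 1 ≤ n) (hnN : n ≤ N) :
    globalErr e (trim e (S N)) (refCount (S N)) ≤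
      (2 * N + 1) / ((N : ℝ) - n + 1) * bestErr top e n := by
  have h1 := HaarQuarklet.globalErr_trim_le (e := e) (hS.isTree N le_rfl)
  have h2 := he.treeErr_root_le hS
  have h3 := he.mul_thr_le_bestErr hS htop hn
  have hn' : (n : ℝ) ≤ N := by exact_mod_cast hnN
  have hpos : 0 < (N : ℝ) - n + 1 := by linarith
  rw [div_mul_eq_mul_div, le_div_iff₀ hpos]
  calc _ ≤ ((2 * N + 1) * thr e S N root) * ((N : ℝ) - n + 1) := by
        gcongr
        exact h1.trans h2
    _ = (2 * N + 1) * (((N : ℝ) - n + 1) * thr e S N root) := by ring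
    _ ≤ _ := by gcongr

end HaarQuarklet

namespace HaarQuarklet

open Node

variable {top : Node → Node} {c : QIdx → ℝ}

/-! ### The local errors of a coefficient sequence -/

/-- Makes the tree-wise requirements on the enrichment sets available at an arbitrary node. -/
theorem IsTree.exists_mem_leaves (l : Node) : ∃ T, IsTree T ∧ l ∈ leaves T := by
  induction l using refinement_induction with
  | hroot =>
    exact ⟨{root}, singleton_root, mem_leaves.2 ⟨Finset.mem_singleton_self _, fun m hm => by
      rw [Finset.mem_singleton.1 hm]
      exact not_isAnc_root _⟩⟩
  | hleft l ih =>
    obtain ⟨T, hT, hl⟩ := ih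
    exact ⟨_, hT.refine_leaf hl, (hT.leaves_refine hl _).2 (Or.inr (Or.inl rfl))⟩
  | hright l ih =>
    obtain ⟨T, hT, hl⟩ := ih
    exact ⟨_, hT.refine_leaf hl, (hT.leaves_refine hl _).2 (Or.inr (Or.inr rfl))⟩

namespace IsEnrichment

theorem exists_leaf_mem_ups (htop : IsEnrichment top) {T : Finset Node} (hT : IsTree T) {m : Node}
    (hm : m ∈ T) : ∃ l ∈ leaves T, m ∈ Ups top l := by
  have : m ∈ ⋃ l ∈ leaves T, Ups top l := by
    rw [htop.cover T hT]
    exact hm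
  simpa using this

theorem disjoint_children (htop : IsEnrichment top) (l : Node) :
    Disjoint (Ups top l.left) (Ups top l.right) := by
  obtain ⟨T, hT, hl⟩ := IsTree.exists_mem_leaves l
  exact htop.disjoint _ (hT.refine_leaf hl) _ ((hT.leaves_refine hl _).2 (Or.inr (Or.inl rfl))) _
    ((hT.leaves_refine hl _).2 (Or.inr (Or.inr rfl))) (left_ne_right l l)

/-- Compare the decompositions before and after splitting the leaf `l`. A node `m ≠ a` already
belonged to the set of some old leaf; if that leaf were not `l`, it would survive the splitting and
its set would meet that of `a`. -/
theorem mem_ups_of_child (htop : IsEnrichment top) {l a m : Node}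
    (ha : a = l.left ∨ a = l.right) (hm : m ∈ Ups top a) : m ∈ Ups top l ∨ m = a := by
  obtain ⟨T, hT, hl⟩ := IsTree.exists_mem_leaves l
  refine or_iff_not_imp_right.2 fun hma => ?_
  have hml : m.IsAncEq l := by
    have h := hm.1.resolve_right hma
    rcases ha with rfl | rfl
    · exact (isAnc_left_iff _ _).1 h
    · exact (isAnc_right_iff _ _).1 h
  obtain ⟨b, hb, hmb⟩ :=
    htop.exists_leaf_mem_ups hT (hT.mem_of_isAncEq hml (leaves_subset T hl))
  by_cases hbl : b = l
  · exact hbl ▸ hmb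
  · have hla : l.IsAnc a := by
      rcases ha with rfl | rfl
      · exact l.isAnc_left
      · exact l.isAnc_right
    have hab : a ≠ b := by
      rintro rfl
      exact (mem_leaves.1 hl).2 _ (leaves_subset T hb) hla
    exact absurd hmb (Set.disjoint_left.1 (htop.disjoint _ (hT.refine_leaf hl) a
      ((hT.leaves_refine hl _).2 (Or.inr ha)) b
      ((hT.leaves_refine hl _).2 (Or.inl ⟨hb, hbl⟩)) hab) hm)

end IsEnrichment

/-- The indices that contribute to the local error `e_p(l)`. -/
def errSet (top : Node → Node) (p : ℕ) (l : Node) : Set QIdx :=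
  {x | base x.2 ∈ Ups top l ∧ p < x.1} ∪ {x | l.IsAnc (base x.2)}

theorem localErr_eq_tsum (hc : Summable fun x => |c x| ^ 2) (p : ℕ) (l : Node) :
    localErr top c p l = ∑' x, (errSet top p l).indicator (fun x => |c x| ^ 2) x := by
  rw [← tsum_subtype, errSet, Summable.tsum_union_disjoint _ (hc.subtype _) (hc.subtype _)]
  · rfl
  · rw [Set.disjoint_left]
    rintro x ⟨h1, -⟩ h2
    exact not_isAnc_self l (IsAnc.trans_isAncEq h2 h1.1)

theorem isLocalError_localErr (htop : IsEnrichment top) (hc : Summable fun x => |c x| ^ 2) :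
    IsLocalError (localErr top c) where
  nonneg p l := by
    rw [localErr_eq_tsum hc]
    exact tsum_nonneg fun x => Set.indicator_nonneg (fun _ _ => by positivity) x
  anti l p p' h := by
    simp only [localErr_eq_tsum hc]
    refine (hc.indicator _).tsum_le_tsum (fun x => ?_) (hc.indicator _)
    refine Set.indicator_le_indicator_of_subset ?_ (fun _ => by positivity) x
    exact Set.union_subset_union_left _ fun x hx => ⟨hx.1, h.trans_lt hx.2⟩
  children_le l := by
    simp only [localErr_eq_tsum hc]
    rw [← (hc.indicator _).tsum_add (hc.indicator _)]
    refine ((hc.indicator _).add (hc.indicator _)).tsum_le_tsum (fun x => ?_) (hc.indicator _)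
    have hdisj : Disjoint (errSet top 0 l.left) (errSet top 0 l.right) := by
      rw [Set.disjoint_left]
      rintro x (⟨h1, -⟩ | h1) (⟨h2, -⟩ | h2)
      · exact Set.disjoint_left.1 (htop.disjoint_children l) h1 h2
      · exact lt_irrefl _ (IsAnc.trans_isAncEq h2 h1.1).level_lt
      · exact lt_irrefl _ (IsAnc.trans_isAncEq h1 h2.1).level_lt
      · exact not_isAncEq_left_and_right l _ ⟨IsAnc.isAncEq h1, IsAnc.isAncEq h2⟩
    -- The only node a child may add to the enrichment set of `l` is the child itself, and its
    -- coefficients of all degrees are contained in the descendant part at `l`.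
    have hsub : errSet top 0 l.left ∪ errSet top 0 l.right ⊆ errSet top 0 l := by
      rintro x ((⟨h1, h2⟩ | h1) | (⟨h1, h2⟩ | h1))
      · rcases htop.mem_ups_of_child (Or.inl rfl) h1 with h | h
        · exact Or.inl ⟨h, h2⟩
        · refine Or.inr ?_
          simpa [h] using l.isAnc_left
      · exact Or.inr (IsAncEq.trans_isAnc l.isAnc_left.isAncEq h1)
      · rcases htop.mem_ups_of_child (Or.inr rfl) h1 with h | h
        · exact Or.inl ⟨h, h2⟩
        · refine Or.inr ?_
          simpa [h] using l.isAnc_right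
      · exact Or.inr (IsAncEq.trans_isAnc l.isAnc_right.isAncEq h1)
    have := Set.indicator_union_of_disjoint hdisj (fun x => |c x| ^ 2)
    rw [← congrFun this x]
    exact Set.indicator_le_indicator_of_subset hsub (fun _ => by positivity) x

theorem mem_indices {T : Finset Node} {P : Node → ℕ} {x : QIdx} :
    x ∈ indices top T P ↔
      (x.2 = none ∨ base x.2 ∈ T) ∧ x.1 ≤ pmax top T P (base x.2) := by
  obtain ⟨p, _ | l⟩ := x
  · simp [indices]
  · simp [indices, base]

/-- An index is missing either because its degree is too large at a node of `T` or because its node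
lies strictly below a leaf. These are the two parts of the error set. -/
theorem notMem_indices_subset (htop : IsEnrichment top) {T : Finset Node} (hT : IsTree T)
    (P : Node → ℕ) {x : QIdx} (hx : x ∉ indices top T P) :
    ∃ l ∈ leaves T, x ∈ errSet top (P l) l := by
  by_cases h : base x.2 ∈ T
  · obtain ⟨l, hl, hxl⟩ := htop.exists_leaf_mem_ups hT h
    refine ⟨l, hl, Or.inl ⟨hxl, ?_⟩⟩
    by_contra hlt
    exact hx (mem_indices.2 ⟨Or.inr h, (not_lt.1 hlt).trans (le_pmax P hl hxl)⟩)
  · obtain ⟨l, hl, hxl⟩ := hT.exists_leaf_isAnc h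
    exact ⟨l, hl, Or.inr hxl⟩

/-- The coefficients outside a quarklet tree are controlled by its global error. -/
theorem tsum_compl_indices_le (htop : IsEnrichment top) (hc : Summable fun x => |c x| ^ 2)
    {T : Finset Node} (hT : IsTree T) (P : Node → ℕ) :
    ∑' x, (indices top T P : Set QIdx)ᶜ.indicator (fun x => |c x| ^ 2) x ≤
      globalErr (localErr top c) T P := by
  simp only [globalErr, localErr_eq_tsum hc]
  rw [← Summable.tsum_finsetSum fun l _ => hc.indicator _]
  refine (hc.indicator _).tsum_le_tsum (fun x => ?_) (summable_sum fun l _ => hc.indicator _)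
  have hnn : ∀ l ∈ leaves T, 0 ≤ (errSet top (P l) l).indicator (fun x => |c x| ^ 2) x :=
    fun l _ => Set.indicator_nonneg (fun _ _ => by positivity) x
  by_cases hx : x ∈ indices top T P
  · rw [Set.indicator_of_notMem (by simpa using hx)]
    exact Finset.sum_nonneg hnn
  · obtain ⟨l, hl, hxl⟩ := notMem_indices_subset htop hT P hx
    rw [Set.indicator_of_mem (by simpa using hx)]
    refine le_trans ?_ (Finset.single_le_sum hnn hl)
    rw [Set.indicator_of_mem hxl]

/-! ### The number of indices -/

theorem card_le_of_sup_level (T : Finset Node) :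
    T.card ≤ (T.sup Node.level + 1) * 2 ^ T.sup Node.level := by
  have : T.card ≤ (Finset.range (T.sup Node.level + 1) ×ˢ
      Finset.range (2 ^ T.sup Node.level)).card := by
    refine Finset.card_le_card_of_injOn (fun l => (l.level, l.pos)) (fun l hl => ?_) ?_
    · have h1 := Finset.le_sup (f := Node.level) hl
      have h2 := l.pos_lt.trans_le (Nat.pow_le_pow_right (by norm_num : 0 < 2) h1)
      simp only [Finset.coe_product, Set.mem_prod, Finset.mem_coe, Finset.mem_range]
      exact ⟨by omega, h2⟩
    · intro a _ b _ h
      simp only [Prod.mk.injEq] at h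
      exact Node.ext h.1 h.2
  simpa using this

/-- The extra 1 next to `T.card` accounts for the quarks. -/
theorem card_indices_le (top : Node → Node) (T : Finset Node) {P : Node → ℕ} {M : ℕ}
    (hP : ∀ l, P l ≤ M) :
    (indices top T P).card ≤ (T.card + 1) * (M + 1) := by
  rw [indices, ← Finset.card_insertNone]
  refine Finset.card_biUnion_le_card_mul _ _ _ fun a _ => Finset.card_image_le.trans ?_
  rw [Finset.card_range]
  exact Nat.succ_le_succ (Finset.sup_le fun l _ => hP l)

theorem IsRun.refCount_le {e : ℕ → Node → ℝ} {S : ℕ → Finset Node} {N : ℕ} (hS : IsRun e S N)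
    (l : Node) : refCount (S N) l ≤ 2 * N := by
  have h1 := hS.card_le N le_rfl
  have h2 : (leavesBelow (S N) l).card ≤ (S N).card :=
    Finset.card_le_card fun m hm => leaves_subset _ (mem_leavesBelow.1 hm).1
  rw [refCount_eq]
  omega

theorem IsRun.card_indices_trim_le {e : ℕ → Node → ℝ} {S : ℕ → Finset Node} {N : ℕ}
    (hS : IsRun e S N) (hN : 1 ≤ N) (top : Node → Node) :
    (indices top (trim e (S N)) (refCount (S N))).card ≤
      3 * (((trim e (S N)).sup Node.level + 1) * 2 ^ (trim e (S N)).sup Node.level + 1) * N := by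
  refine (card_indices_le top _ hS.refCount_le).trans ?_
  -- Degrees are at most `2 N`, and `2 N + 1 ≤ 3 N` because `N ≥ 1`.
  calc _ ≤ (((trim e (S N)).sup Node.level + 1) * 2 ^ (trim e (S N)).sup Node.level + 1) *
        (3 * N) :=
        Nat.mul_le_mul (Nat.succ_le_succ (card_le_of_sup_level _)) (by omega)
    _ = _ := by ring

end HaarQuarklet

namespace HaarQuarklet

open Node

/-! ### Elementary properties of Haar quarklets -/

theorem quark_nonneg (p : ℕ) (x : ℝ) : 0 ≤ quark p x :=
  Set.indicator_nonneg (fun _ hx => pow_nonneg hx.1 p) x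

theorem quark_le_one (p : ℕ) (x : ℝ) : quark p x ≤ 1 := (le_abs_self _).trans (abs_quark_le p x)

theorem quark_eq_zero {p : ℕ} {x : ℝ} (hx : x ∉ Set.Ico (0 : ℝ) 1) : quark p x = 0 :=
  Set.indicator_of_notMem hx _

theorem integrable_quark (p : ℕ) : Integrable (quark p) := by
  refine (integrable_indicator_iff measurableSet_Ico).2 ?_
  exact ((continuous_pow p).integrableOn_Icc).mono_set Set.Ico_subset_Icc_self

theorem integral_quark (p : ℕ) : ∫ x, quark p x = ((p : ℝ) + 1)⁻¹ := by
  unfold quark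
  rw [integral_indicator measurableSet_Ico, integral_Ico_eq_integral_Ioc,
    ← intervalIntegral.integral_of_le zero_le_one, integral_pow]
  simp

theorem integrable_quark_two_mul (p : ℕ) : Integrable fun x => quark p (2 * x) :=
  (integrable_quark p).comp_mul_left' two_ne_zero

theorem integrable_quark_two_mul_sub (p : ℕ) : Integrable fun x => quark p (2 * x - 1) :=
  ((integrable_quark p).comp_sub_right 1).comp_mul_left' two_ne_zero

theorem integral_quark_two_mul (p : ℕ) : ∫ x, quark p (2 * x) = 2⁻¹ * ((p : ℝ) + 1)⁻¹ := by
  rw [Measure.integral_comp_mul_left (quark p) 2, integral_quark]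
  simp

theorem integral_quark_two_mul_sub (p : ℕ) :
    ∫ x, quark p (2 * x - 1) = 2⁻¹ * ((p : ℝ) + 1)⁻¹ := by
  rw [Measure.integral_comp_mul_left (fun x => quark p (x - 1)) 2,
    integral_sub_right_eq_self (quark p), integral_quark]
  simp

theorem integrable_quarklet (p : ℕ) : Integrable (quarklet p) :=
  (integrable_quark_two_mul p).sub (integrable_quark_two_mul_sub p)

theorem integral_quarklet (p : ℕ) : ∫ x, quarklet p x = 0 := by
  unfold quarklet
  rw [integral_sub (integrable_quark_two_mul p) (integrable_quark_two_mul_sub p),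
    integral_quark_two_mul, integral_quark_two_mul_sub, sub_self]

/-- The source of the decay in `p` of the quarklet Gram estimates; the sup norm and the variation
are only bounded. -/
theorem integral_abs_quarklet_le (p : ℕ) : ∫ x, |quarklet p x| ≤ ((p : ℝ) + 1)⁻¹ := by
  calc ∫ x, |quarklet p x| ≤ ∫ x, (quark p (2 * x) + quark p (2 * x - 1)) := by
        refine integral_mono (integrable_quarklet p).abs
          ((integrable_quark_two_mul p).add (integrable_quark_two_mul_sub p)) fun x => ?_
        refine (abs_sub _ _).trans_eq ?_
        rw [abs_of_nonneg (quark_nonneg _ _), abs_of_nonneg (quark_nonneg _ _)]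
    _ = ((p : ℝ) + 1)⁻¹ := by
        rw [integral_add (integrable_quark_two_mul p) (integrable_quark_two_mul_sub p),
          integral_quark_two_mul, integral_quark_two_mul_sub]
        ring

theorem abs_quarklet_le_one (p : ℕ) (x : ℝ) : |quarklet p x| ≤ 1 := by
  unfold quarklet
  rw [abs_le]
  constructor <;>
  linarith [quark_nonneg p (2 * x), quark_nonneg p (2 * x - 1), quark_le_one p (2 * x),
    quark_le_one p (2 * x - 1)]

theorem quarklet_eq_zero {p : ℕ} {x : ℝ} (hx : x ∉ Set.Ico (0 : ℝ) 1) : quarklet p x = 0 := by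
  unfold quarklet
  rw [quark_eq_zero, quark_eq_zero, sub_zero]
  · exact fun h => hx ⟨by linarith [h.1], by linarith [h.2]⟩
  · exact fun h => hx ⟨by linarith [h.1], by linarith [h.2]⟩

theorem two_rpow_half (j : ℕ) : (2 : ℝ) ^ ((j : ℝ) / 2) = √2 ^ j := by
  rw [Real.sqrt_eq_rpow, ← Real.rpow_natCast, ← Real.rpow_mul (by norm_num)]
  congr 1
  ring

theorem quarkletFun_some (p : ℕ) (l : Node) (t : ℝ) :
    quarkletFun (p, some l) t = √2 ^ l.level * quarklet p (2 ^ l.level * t - l.pos) := by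
  rw [quarkletFun, two_rpow_half]

theorem mem_interval_iff (l : Node) (t : ℝ) :
    t ∈ l.interval ↔ 2 ^ l.level * t - l.pos ∈ Set.Ico (0 : ℝ) 1 := by
  have : (0 : ℝ) < 2 ^ l.level := by positivity
  rw [interval, Set.mem_Ico, Set.mem_Ico, div_le_iff₀ this, lt_div_iff₀ this]
  constructor <;> rintro ⟨h1, h2⟩ <;> constructor <;> linarith

theorem quarkletFun_eq_zero {p : ℕ} {l : Node} {t : ℝ} (ht : t ∉ l.interval) :
    quarkletFun (p, some l) t = 0 := by
  rw [quarkletFun_some, quarklet_eq_zero (by rwa [mem_interval_iff] at ht), mul_zero]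

theorem interval_subset_Icc (l : Node) : l.interval ⊆ Set.Icc 0 1 := by
  intro t ht
  have h : t ∈ root.interval := (isAncEq_iff_subset _ _).1 (root_isAncEq l) ht
  rw [mem_interval_iff] at h
  simp only [root, pow_zero, one_mul, Nat.cast_zero, sub_zero] at h
  exact ⟨h.1, h.2.le⟩

theorem abs_quarkletFun_le (p : ℕ) (l : Node) (t : ℝ) :
    |quarkletFun (p, some l) t| ≤ √2 ^ l.level := by
  rw [quarkletFun_some, abs_mul, abs_of_nonneg (by positivity)]
  exact mul_le_of_le_one_right (by positivity) (abs_quarklet_le_one _ _)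

theorem integral_muI_eq {g : ℝ → ℝ} {l : Node} (hg : ∀ t ∉ l.interval, g t = 0) :
    ∫ t, g t ∂muI = ∫ t, g t :=
  setIntegral_eq_integral_of_forall_compl_eq_zero fun t ht =>
    hg t fun h => ht (interval_subset_Icc l h)

theorem integral_affine (g : ℝ → ℝ) (l : Node) :
    ∫ t, g (2 ^ l.level * t - l.pos) = (2 ^ l.level)⁻¹ * ∫ t, g t := by
  rw [Measure.integral_comp_mul_left (fun x => g (x - l.pos)) (2 ^ l.level),
    integral_sub_right_eq_self g, abs_of_nonneg (by positivity), smul_eq_mul]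

theorem integral_quarkletFun (p : ℕ) (l : Node) : ∫ t, quarkletFun (p, some l) t ∂muI = 0 := by
  rw [integral_muI_eq fun t ht => quarkletFun_eq_zero ht]
  simp only [quarkletFun_some]
  rw [integral_const_mul, integral_affine, integral_quarklet, mul_zero, mul_zero]

theorem integral_abs_quarkletFun_le (p : ℕ) (l : Node) :
    ∫ t, |quarkletFun (p, some l) t| ∂muI ≤ (√2)⁻¹ ^ l.level * ((p : ℝ) + 1)⁻¹ := by
  rw [integral_muI_eq (l := l) fun t ht => by rw [quarkletFun_eq_zero ht, abs_zero]]
  have h2 : (2 : ℝ) ^ l.level = √2 ^ l.level * √2 ^ l.level := by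
    rw [← mul_pow, Real.mul_self_sqrt (by norm_num)]
  have hpos : (0 : ℝ) < √2 ^ l.level := by positivity
  simp only [quarkletFun_some, abs_mul, abs_of_nonneg hpos.le]
  rw [integral_const_mul, integral_affine (fun x => |quarklet p x|), ← mul_assoc]
  have : √2 ^ l.level * (2 ^ l.level)⁻¹ = (√2)⁻¹ ^ l.level := by
    rw [h2, inv_pow]
    field_simp
  rw [this]
  gcongr
  exact integral_abs_quarklet_le p

theorem integrable_quarkletFun_mul (p : ℕ) (a b : Option Node) :
    Integrable (fun t => quarkletFun (p, a) t * quarkletFun (p, b) t) muI :=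
  (memLp_quarkletFun (p, a)).integrable_mul (memLp_quarkletFun (p, b))

theorem integrable_quarkletFun (x : QIdx) : Integrable (quarkletFun x) muI :=
  (memLp_quarkletFun x).integrable (by norm_num)

theorem inner_quarkletL2 (x y : QIdx) :
    inner ℝ (quarkletL2 x) (quarkletL2 y) = ∫ t, quarkletFun x t * quarkletFun y t ∂muI := by
  rw [L2.inner_def]
  refine integral_congr_ae ?_
  filter_upwards [(memLp_quarkletFun x).coeFn_toLp, (memLp_quarkletFun y).coeFn_toLp] with t h1 h2
  rw [quarkletL2, quarkletL2, h1, h2]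
  simp [mul_comm]

/-! ### Almost orthogonality of quarklets of a fixed degree -/

theorem eq_of_mem_interval {l m : Node} {t : ℝ} (hlev : l.level = m.level) (hl : t ∈ l.interval)
    (hm : t ∈ m.interval) : l = m := by
  rw [mem_interval_iff] at hl hm
  rw [hlev] at hl
  refine Node.ext hlev ?_
  have h1 : (l.pos : ℝ) < m.pos + 1 := by linarith [hl.1, hm.2]
  have h2 : (m.pos : ℝ) < l.pos + 1 := by linarith [hm.1, hl.2]
  have h1' : l.pos < m.pos + 1 := by exact_mod_cast h1
  have h2' : m.pos < l.pos + 1 := by exact_mod_cast h2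
  omega

theorem sum_abs_quarkletFun_le (p j : ℕ) (F : Finset Node) (hF : ∀ m ∈ F, m.level = j) (t : ℝ) :
    ∑ m ∈ F, |quarkletFun (p, some m) t| ≤ √2 ^ j := by
  by_cases h : ∃ m ∈ F, t ∈ m.interval
  · obtain ⟨m, hm, ht⟩ := h
    rw [Finset.sum_eq_single_of_mem m hm fun a ha hne => ?_]
    · exact hF m hm ▸ abs_quarkletFun_le p m t
    · rw [quarkletFun_eq_zero, abs_zero]
      exact fun h => hne (eq_of_mem_interval ((hF a ha).trans (hF m hm).symm) h ht)
  · push Not at h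
    rw [Finset.sum_eq_zero fun m hm => by rw [quarkletFun_eq_zero (h m hm), abs_zero]]
    positivity

/-- Supports on one level are disjoint, so the sum over `m` is bounded pointwise and only the L1
norm of the quarklet at `l` remains. No cancellation is used. -/
theorem sum_abs_inner_coarse_le (p j : ℕ) (l : Node) (F : Finset Node)
    (hF : ∀ m ∈ F, m.level = j) :
    ∑ m ∈ F, |inner ℝ (quarkletL2 (p, some l)) (quarkletL2 (p, some m))| ≤
      √2 ^ j * ((√2)⁻¹ ^ l.level * ((p : ℝ) + 1)⁻¹) := by
  have hint : ∀ m, Integrable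
      (fun t => |quarkletFun (p, some l) t * quarkletFun (p, some m) t|) muI :=
    fun m => (integrable_quarkletFun_mul p (some l) (some m)).abs
  calc _ ≤ ∑ m ∈ F, ∫ t, |quarkletFun (p, some l) t * quarkletFun (p, some m) t| ∂muI := by
        refine Finset.sum_le_sum fun m _ => ?_
        rw [inner_quarkletL2]
        exact abs_integral_le_integral_abs
    _ = ∫ t, ∑ m ∈ F, |quarkletFun (p, some l) t * quarkletFun (p, some m) t| ∂muI :=
        (integral_finsetSum F fun m _ => hint m).symm
    _ ≤ ∫ t, √2 ^ j * |quarkletFun (p, some l) t| ∂muI := by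
        refine integral_mono (integrable_finsetSum F fun m _ => hint m)
          ((integrable_quarkletFun _).abs.const_mul _) fun t => ?_
        simp only [abs_mul]
        rw [← Finset.mul_sum, mul_comm]
        exact mul_le_mul_of_nonneg_right (sum_abs_quarkletFun_le p j F hF t) (abs_nonneg _)
    _ ≤ _ := by
        rw [integral_const_mul]
        gcongr
        exact integral_abs_quarkletFun_le p l

/-- The monotone function which agrees with the quark `φ_p` on `[0, 1)`. -/
noncomputable def clampPow (p : ℕ) (x : ℝ) : ℝ := max 0 (min x 1) ^ p

theorem monotone_clampPow (p : ℕ) : Monotone (clampPow p) := fun x y h => by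
  unfold clampPow
  gcongr

theorem clampPow_nonneg (p : ℕ) (x : ℝ) : 0 ≤ clampPow p x :=
  pow_nonneg (le_max_left _ _) p

theorem clampPow_le_one (p : ℕ) (x : ℝ) : clampPow p x ≤ 1 :=
  pow_le_one₀ (le_max_left _ _) (max_le zero_le_one (min_le_right _ _))

/-- Quarks jump only at integers. Between consecutive integers the quark is either zero or coincides
with the monotone `clampPow`, whose increment dominates. -/
theorem abs_quark_sub_le {p : ℕ} {a b u : ℝ} {i : ℤ} (hia : (i : ℝ) ≤ a) (hbi : b ≤ i + 1)
    (hau : a ≤ u) (hub : u < b) :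
    |quark p u - quark p a| ≤ clampPow p b - clampPow p a := by
  have hab := monotone_clampPow p (hau.trans hub.le)
  by_cases h : i = 0
  · have eq : ∀ v, a ≤ v → v < b → quark p v = clampPow p v := by
      intro v h1 h2
      subst h
      push_cast at hia hbi
      have hv : v ∈ Set.Ico (0 : ℝ) 1 := ⟨by linarith, by linarith⟩
      rw [quark, Set.indicator_of_mem hv, clampPow, min_eq_left hv.2.le, max_eq_right hv.1]
    rw [eq u hau hub, eq a le_rfl (by linarith), abs_of_nonneg]
    · linarith [monotone_clampPow p hub.le]
    · linarith [monotone_clampPow p hau]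
  · have eq : ∀ v, a ≤ v → v < b → quark p v = 0 := by
      refine fun v h1 h2 => quark_eq_zero fun hv => h ?_
      have h3 : (i : ℝ) < 1 := by linarith [hv.2]
      have h4 : (-1 : ℝ) < i := by linarith [hv.1]
      have h3' : i < 1 := by exact_mod_cast h3
      have h4' : -1 < i := by exact_mod_cast h4
      omega
    rw [eq u hau hub, eq a le_rfl (by linarith), sub_zero, abs_zero]
    linarith

/-- A monotone majorant of the variation of the quarklet `ψ_{p,l}`. -/
noncomputable def variation (p : ℕ) (l : Node) (t : ℝ) : ℝ :=
  √2 ^ l.level * (clampPow p (2 * (2 ^ l.level * t - l.pos)) +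
    clampPow p (2 * (2 ^ l.level * t - l.pos) - 1))

theorem monotone_variation (p : ℕ) (l : Node) : Monotone (variation p l) := fun x y h => by
  have h' : (2 : ℝ) * (2 ^ l.level * x - l.pos) ≤ 2 * (2 ^ l.level * y - l.pos) := by gcongr
  exact mul_le_mul_of_nonneg_left (add_le_add (monotone_clampPow p h')
    (monotone_clampPow p (by linarith))) (by positivity)

theorem variation_nonneg (p : ℕ) (l : Node) (t : ℝ) : 0 ≤ variation p l t :=
  mul_nonneg (by positivity) (add_nonneg (clampPow_nonneg _ _) (clampPow_nonneg _ _))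

theorem variation_le (p : ℕ) (l : Node) (t : ℝ) : variation p l t ≤ √2 ^ l.level * 2 := by
  refine mul_le_mul_of_nonneg_left ?_ (by positivity)
  linarith [clampPow_le_one p (2 * (2 ^ l.level * t - l.pos)),
    clampPow_le_one p (2 * (2 ^ l.level * t - l.pos) - 1)]

theorem abs_quarkletFun_sub_le (p : ℕ) {l m : Node} (hlm : l.level < m.level) {t : ℝ}
    (ht : t ∈ m.interval) :
    |quarkletFun (p, some l) t - quarkletFun (p, some l) (m.pos / 2 ^ m.level)| ≤
      variation p l ((m.pos + 1) / 2 ^ m.level) - variation p l (m.pos / 2 ^ m.level) := by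
  obtain ⟨i, hi⟩ := Nat.exists_eq_add_of_lt hlm
  set a : ℝ := m.pos / 2 ^ m.level with ha
  set b : ℝ := (m.pos + 1) / 2 ^ m.level with hb
  have hI : (0 : ℝ) < 2 ^ i := by positivity
  have hL : (0 : ℝ) < 2 ^ l.level := by positivity
  have scale : ∀ x : ℝ, 2 * (2 ^ l.level * (x / 2 ^ m.level) - l.pos) =
      x / 2 ^ i - 2 * l.pos := by
    intro x
    rw [hi, pow_succ, pow_add]
    field_simp
  -- As `m` is strictly finer than `l`, scaling by `2 ^ (l.level + 1)` sends its interval into `[n,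
  -- n + 1]`; no jump of the quarklet lies inside.
  let n : ℕ := m.pos / 2 ^ i
  have hn1 : (n : ℝ) ≤ m.pos / 2 ^ i := by
    rw [le_div_iff₀ hI]
    exact_mod_cast Nat.div_mul_le_self m.pos (2 ^ i)
  have hn2 : ((m.pos : ℝ) + 1) / 2 ^ i ≤ n + 1 := by
    rw [div_le_iff₀ hI]
    have : m.pos + 1 ≤ (m.pos / 2 ^ i + 1) * 2 ^ i := by
      rw [mul_comm]
      exact Nat.lt_mul_div_succ m.pos (by positivity)
    exact_mod_cast this
  have ht1 : 2 * (2 ^ l.level * a - l.pos) ≤ 2 * (2 ^ l.level * t - l.pos) := by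
    have := ht.1
    gcongr
  have ht2 : 2 * (2 ^ l.level * t - l.pos) < 2 * (2 ^ l.level * b - l.pos) := by
    have := ht.2
    gcongr
  have hA : (((n : ℤ) - 2 * l.pos : ℤ) : ℝ) ≤ 2 * (2 ^ l.level * a - l.pos) := by
    rw [ha, scale]
    push_cast
    linarith
  have hB : 2 * (2 ^ l.level * b - l.pos) ≤ (((n : ℤ) - 2 * l.pos : ℤ) : ℝ) + 1 := by
    rw [hb, scale]
    push_cast
    linarith
  have h1 := abs_quark_sub_le (p := p) hA hB ht1 ht2
  have h2 := abs_quark_sub_le (p := p) (i := (n : ℤ) - 2 * l.pos - 1)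
    (a := 2 * (2 ^ l.level * a - l.pos) - 1) (b := 2 * (2 ^ l.level * b - l.pos) - 1)
    (u := 2 * (2 ^ l.level * t - l.pos) - 1) (by push_cast at hA ⊢; linarith)
    (by push_cast at hB ⊢; linarith) (by linarith) (by linarith)
  rw [quarkletFun_some, quarkletFun_some, ← mul_sub, abs_mul, abs_of_nonneg (by positivity),
    variation, variation, ← mul_sub]
  refine mul_le_mul_of_nonneg_left ?_ (by positivity)
  rw [quarklet, quarklet, abs_le]
  rw [abs_le] at h1 h2
  constructor <;> linarith [h1.1, h1.2, h2.1, h2.2]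

/-- The fine quarklet has mean zero, so the coarse one may be replaced by its deviation from its
value at the left endpoint. -/
theorem abs_inner_fine_le (p : ℕ) {l m : Node} (hlm : l.level < m.level) :
    |inner ℝ (quarkletL2 (p, some l)) (quarkletL2 (p, some m))| ≤
      (variation p l ((m.pos + 1) / 2 ^ m.level) - variation p l (m.pos / 2 ^ m.level)) *
        ((√2)⁻¹ ^ m.level * ((p : ℝ) + 1)⁻¹) := by
  set V := variation p l ((m.pos + 1) / 2 ^ m.level) - variation p l (m.pos / 2 ^ m.level)
  set κ := quarkletFun (p, some l) (m.pos / 2 ^ m.level)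
  have hV : 0 ≤ V := sub_nonneg.2 (monotone_variation p l (by gcongr; linarith))
  have hm := integrable_quarkletFun (p, some m)
  have hlm' := integrable_quarkletFun_mul p (some l) (some m)
  have h1 : inner ℝ (quarkletL2 (p, some l)) (quarkletL2 (p, some m)) =
      ∫ t, (quarkletFun (p, some l) t - κ) * quarkletFun (p, some m) t ∂muI := by
    simp only [sub_mul]
    rw [inner_quarkletL2, integral_sub hlm' (hm.const_mul κ), integral_const_mul,
      integral_quarkletFun, mul_zero, sub_zero]
  have hint : Integrable
      (fun t => (quarkletFun (p, some l) t - κ) * quarkletFun (p, some m) t) muI := by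
    simp only [sub_mul]
    exact hlm'.sub (hm.const_mul κ)
  rw [h1]
  calc _ ≤ ∫ t, |(quarkletFun (p, some l) t - κ) * quarkletFun (p, some m) t| ∂muI :=
        abs_integral_le_integral_abs
    _ ≤ ∫ t, V * |quarkletFun (p, some m) t| ∂muI := by
        refine integral_mono hint.abs (hm.abs.const_mul V) fun t => ?_
        simp only [abs_mul]
        by_cases ht : t ∈ m.interval
        · exact mul_le_mul_of_nonneg_right (abs_quarkletFun_sub_le p hlm ht) (abs_nonneg _)
        · rw [quarkletFun_eq_zero ht, abs_zero, mul_zero, mul_zero]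
    _ ≤ _ := by
        rw [integral_const_mul]
        gcongr
        exact integral_abs_quarkletFun_le p m

/-- The increments of the monotone `variation` over adjacent intervals telescope to its total
increment, uniformly in `p`. -/
theorem sum_abs_inner_fine_le (p j : ℕ) (l : Node) (hj : l.level < j) (F : Finset Node)
    (hF : ∀ m ∈ F, m.level = j) :
    ∑ m ∈ F, |inner ℝ (quarkletL2 (p, some l)) (quarkletL2 (p, some m))| ≤
      √2 ^ l.level * 2 * ((√2)⁻¹ ^ j * ((p : ℝ) + 1)⁻¹) := by
  let V : ℕ → ℝ := fun k => variation p l ((k : ℝ) / 2 ^ j)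
  have hV : ∀ k, 0 ≤ V (k + 1) - V k := fun k =>
    sub_nonneg.2 (monotone_variation p l (by gcongr; linarith))
  calc _ ≤ ∑ m ∈ F, (V (m.pos + 1) - V m.pos) * ((√2)⁻¹ ^ j * ((p : ℝ) + 1)⁻¹) := by
        refine Finset.sum_le_sum fun m hm => ?_
        have := abs_inner_fine_le p (l := l) (m := m) (by rwa [hF m hm])
        simpa only [hF m hm, V, Nat.cast_add, Nat.cast_one] using this
    _ = (∑ k ∈ F.image Node.pos, (V (k + 1) - V k)) * ((√2)⁻¹ ^ j * ((p : ℝ) + 1)⁻¹) := by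
        rw [← Finset.sum_mul, Finset.sum_image]
        exact fun a ha b hb h => Node.ext ((hF a ha).trans (hF b hb).symm) h
    _ ≤ (∑ k ∈ Finset.range (2 ^ j), (V (k + 1) - V k)) * ((√2)⁻¹ ^ j * ((p : ℝ) + 1)⁻¹) := by
        gcongr
        · exact fun k _ _ => hV k
        · intro k hk
          obtain ⟨m, hm, rfl⟩ := Finset.mem_image.1 hk
          exact Finset.mem_range.2 (hF m hm ▸ m.pos_lt)
    _ ≤ _ := by
        rw [Finset.sum_range_sub]
        gcongr
        have h0 : 0 ≤ V 0 := variation_nonneg p l _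
        have h1 : V (2 ^ j) ≤ √2 ^ l.level * 2 := variation_le p l _
        linarith

theorem inv_sqrt_two_le : (√2)⁻¹ ≤ (3 / 4 : ℝ) := by
  have h : (4 / 3 : ℝ) ≤ √2 := Real.le_sqrt_of_sq_le (by norm_num)
  exact (inv_anti₀ (by norm_num) h).trans_eq (by norm_num)

theorem geom_sum_le_four (n : ℕ) : ∑ i ∈ Finset.range n, (√2)⁻¹ ^ i ≤ 4 := by
  have h1 := inv_sqrt_two_le
  have h0 : (0 : ℝ) ≤ (√2)⁻¹ := by positivity
  calc _ ≤ ∑ i ∈ Finset.range n, (3 / 4 : ℝ) ^ i := by gcongr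
    _ ≤ ∑' i : ℕ, (3 / 4 : ℝ) ^ i :=
        (summable_geometric_of_lt_one (by norm_num) (by norm_num)).sum_le_tsum _
          fun _ _ => by positivity
    _ = 4 := by
        rw [tsum_geometric_of_lt_one (by norm_num) (by norm_num)]
        norm_num

/-- With truncated subtraction the exponent is the distance of `i` and `j`; each side contributes a
geometric sum. -/
theorem sum_geom_dist_le (j M : ℕ) :
    ∑ i ∈ Finset.range M, (√2)⁻¹ ^ ((j - i) + (i - j)) ≤ 8 := by
  calc _ ≤ ∑ i ∈ Finset.range (j + 1 + M), (√2)⁻¹ ^ ((j - i) + (i - j)) :=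
        Finset.sum_le_sum_of_subset_of_nonneg
          (Finset.range_subset_range.2 (by omega)) fun _ _ _ => by positivity
    _ = ∑ i ∈ Finset.range (j + 1), (√2)⁻¹ ^ i +
        (√2)⁻¹ * ∑ i ∈ Finset.range M, (√2)⁻¹ ^ i := by
        rw [Finset.sum_range_add, Finset.mul_sum]
        congr 1
        · rw [← Finset.sum_range_reflect (fun i => (√2)⁻¹ ^ i)]
          refine Finset.sum_congr rfl fun i hi => ?_
          rw [Finset.mem_range] at hi
          congr 1
          omega
        · refine Finset.sum_congr rfl fun i _ => ?_
          rw [← pow_succ']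
          congr 1
          omega
    _ ≤ 8 := by
        have h1 := geom_sum_le_four (j + 1)
        have h2 := geom_sum_le_four M
        have h3 := inv_sqrt_two_le
        have h0 : (0 : ℝ) ≤ (√2)⁻¹ := by positivity
        nlinarith

theorem sum_abs_inner_le (p : ℕ) (l : Node) (F : Finset Node) :
    ∑ m ∈ F, |inner ℝ (quarkletL2 (p, some l)) (quarkletL2 (p, some m))| ≤
      16 * ((p : ℝ) + 1)⁻¹ := by
  have hs : √2 * (√2)⁻¹ = 1 := mul_inv_cancel₀ (by positivity)
  have hpow : ∀ i k : ℕ, √2 ^ i * (√2)⁻¹ ^ (i + k) = (√2)⁻¹ ^ k := by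
    intro i k
    rw [pow_add, ← mul_assoc, ← mul_pow, hs, one_pow, one_mul]
  rw [← Finset.sum_fiberwise_of_maps_to (t := Finset.range (F.sup Node.level + 1))
    (g := Node.level) fun m hm =>
      Finset.mem_range.2 (Nat.lt_succ_of_le (Finset.le_sup (f := Node.level) hm))]
  calc _ ≤ ∑ j ∈ Finset.range (F.sup Node.level + 1),
        (√2)⁻¹ ^ ((l.level - j) + (j - l.level)) * (2 * ((p : ℝ) + 1)⁻¹) := by
        refine Finset.sum_le_sum fun j _ => ?_
        have hF : ∀ m ∈ F.filter (fun m => m.level = j), m.level = j :=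
          fun m hm => (Finset.mem_filter.1 hm).2
        rcases lt_or_ge l.level j with h | h
        · refine (sum_abs_inner_fine_le p j l h _ hF).trans_eq ?_
          obtain ⟨k, rfl⟩ := Nat.exists_eq_add_of_le h.le
          rw [show l.level - (l.level + k) + (l.level + k - l.level) = k by omega, ← hpow l.level k]
          ring
        · refine (sum_abs_inner_coarse_le p j l _ hF).trans ?_
          obtain ⟨k, hk⟩ := Nat.exists_eq_add_of_le h
          rw [hk, show j + k - j + (j - (j + k)) = k by omega, ← mul_assoc, hpow]
          have : (0 : ℝ) ≤ ((p : ℝ) + 1)⁻¹ := by positivity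
          gcongr
          linarith
    _ ≤ 8 * (2 * ((p : ℝ) + 1)⁻¹) := by
        rw [← Finset.sum_mul]
        gcongr
        exact sum_geom_dist_le _ _
    _ = _ := by ring

/-- Schur test for a finite family of vectors. -/
theorem norm_sum_smul_sq_le {ι H : Type*} [NormedAddCommGroup H] [InnerProductSpace ℝ H]
    (F : Finset ι) (v : ι → H) {B : ℝ} (hB : ∀ i ∈ F, ∑ k ∈ F, |inner ℝ (v i) (v k)| ≤ B)
    (d : ι → ℝ) : ‖∑ i ∈ F, d i • v i‖ ^ 2 ≤ B * ∑ i ∈ F, d i ^ 2 := by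
  have hsym : ∑ i ∈ F, ∑ k ∈ F, d k ^ 2 * |inner ℝ (v i) (v k)| =
      ∑ i ∈ F, ∑ k ∈ F, d i ^ 2 * |inner ℝ (v i) (v k)| := by
    rw [Finset.sum_comm]
    simp only [real_inner_comm]
  calc ‖∑ i ∈ F, d i • v i‖ ^ 2
      = ∑ i ∈ F, ∑ k ∈ F, d i * (d k * inner ℝ (v i) (v k)) := by
        rw [← real_inner_self_eq_norm_sq, sum_inner]
        refine Finset.sum_congr rfl fun i _ => ?_
        rw [inner_sum]
        refine Finset.sum_congr rfl fun k _ => ?_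
        rw [real_inner_smul_left, real_inner_smul_right]
    _ ≤ ∑ i ∈ F, ∑ k ∈ F, (2⁻¹ * (d i ^ 2 * |inner ℝ (v i) (v k)|) +
          2⁻¹ * (d k ^ 2 * |inner ℝ (v i) (v k)|)) := by
        refine Finset.sum_le_sum fun i _ => Finset.sum_le_sum fun k _ => ?_
        have h1 : |d i| * |d k| ≤ 2⁻¹ * (d i ^ 2 + d k ^ 2) := by
          nlinarith [sq_nonneg (|d i| - |d k|), sq_abs (d i), sq_abs (d k)]
        calc _ ≤ |d i * (d k * inner ℝ (v i) (v k))| := le_abs_self _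
          _ = (|d i| * |d k|) * |inner ℝ (v i) (v k)| := by rw [abs_mul, abs_mul, mul_assoc]
          _ ≤ (2⁻¹ * (d i ^ 2 + d k ^ 2)) * |inner ℝ (v i) (v k)| := by gcongr
          _ = _ := by ring
    _ = ∑ i ∈ F, d i ^ 2 * ∑ k ∈ F, |inner ℝ (v i) (v k)| := by
        simp only [Finset.sum_add_distrib, ← Finset.mul_sum]
        simp only [← Finset.mul_sum] at hsym
        rw [hsym]
        ring
    _ ≤ ∑ i ∈ F, d i ^ 2 * B :=
        Finset.sum_le_sum fun i hi => mul_le_mul_of_nonneg_left (hB i hi) (sq_nonneg _)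
    _ = _ := by rw [← Finset.sum_mul, mul_comm]

/-! ### Stability of quarklet expansions -/

theorem norm_quarkletL2_none_sq_le (p : ℕ) : ‖quarkletL2 (p, none)‖ ^ 2 ≤ ((p : ℝ) + 1)⁻¹ := by
  rw [← real_inner_self_eq_norm_sq, inner_quarkletL2]
  calc _ ≤ ∫ t, quark p t ∂muI := by
        refine integral_mono (integrable_quarkletFun_mul p none none)
          (integrable_quark p).integrableOn fun t => ?_
        exact mul_le_of_le_one_right (quark_nonneg p t) (quark_le_one p t)
    _ ≤ ∫ t, quark p t :=
        setIntegral_le_integral (integrable_quark p) (ae_of_all _ (quark_nonneg p))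
    _ = _ := integral_quark p

/-- The quark is split off by (x + y)² ≤ 2x² + 2y², which doubles the Schur constant 16. -/
theorem norm_sum_degree_sq_le (p : ℕ) (d : Option Node → ℝ) (F : Finset Node) :
    ‖∑ a ∈ Finset.insertNone F, d a • quarkletL2 (p, a)‖ ^ 2 ≤
      32 * ((p : ℝ) + 1)⁻¹ * ∑ a ∈ Finset.insertNone F, d a ^ 2 := by
  rw [Finset.sum_insertNone, Finset.sum_insertNone]
  have h1 : ‖d none • quarkletL2 (p, none)‖ ^ 2 ≤ 16 * ((p : ℝ) + 1)⁻¹ * d none ^ 2 := by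
    rw [norm_smul, mul_pow, Real.norm_eq_abs, sq_abs, mul_comm]
    refine mul_le_mul_of_nonneg_right ((norm_quarkletL2_none_sq_le p).trans ?_) (sq_nonneg _)
    have : (0 : ℝ) ≤ ((p : ℝ) + 1)⁻¹ := by positivity
    linarith
  have h2 := norm_sum_smul_sq_le F (fun l => quarkletL2 (p, some l))
    (fun l _ => sum_abs_inner_le p l F) (fun l => d (some l))
  have h3 := norm_add_le (d none • quarkletL2 (p, none))
    (∑ l ∈ F, d (some l) • quarkletL2 (p, some l))
  set x := ‖d none • quarkletL2 (p, none)‖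
  set y := ‖∑ l ∈ F, d (some l) • quarkletL2 (p, some l)‖
  have h4 := pow_le_pow_left₀ (norm_nonneg _) h3 2
  nlinarith [sq_nonneg (x - y)]

/-- The upper stability estimate for weighted quarklet expansions. -/
theorem exists_norm_partialSum_sq_le {w : ℕ → ℝ} (hw : ∀ p, 0 ≤ w p)
    (hsum : Summable fun p : ℕ => w p * ((p : ℝ) + 1) ^ (-(1 / 2) : ℝ)) :
    ∃ C : ℝ, 0 < C ∧ ∀ (c : QIdx → ℝ) (A : Finset QIdx),
      ‖partialSum w c A‖ ^ 2 ≤ C * ∑ x ∈ A, |c x| ^ 2 := by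
  set b : ℕ → ℝ := fun p => w p * ((p : ℝ) + 1) ^ (-(1 / 2) : ℝ) with hb
  have hb0 : ∀ p, 0 ≤ b p := fun p => mul_nonneg (hw p) (by positivity)
  have hbsq : ∀ p, b p ^ 2 = w p ^ 2 * ((p : ℝ) + 1)⁻¹ := by
    intro p
    have hp : (0 : ℝ) ≤ (p : ℝ) + 1 := by positivity
    rw [hb, mul_pow, ← Real.rpow_natCast (((p : ℝ) + 1) ^ _), ← Real.rpow_mul hp,
      ← Real.rpow_neg_one]
    norm_num
  -- The summand 1 only secures positivity.
  refine ⟨32 * (∑' p, b p) ^ 2 + 1, by positivity, fun c A => ?_⟩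
  classical
  obtain ⟨M, F, hMF⟩ : ∃ (M : ℕ) (F : Finset Node), A ⊆ Finset.range M ×ˢ Finset.insertNone F := by
    refine ⟨(A.image Prod.fst).sup id + 1, (A.image Prod.snd).eraseNone, fun x hx => ?_⟩
    have h1 : x.1 ≤ (A.image Prod.fst).sup id :=
      Finset.le_sup (f := id) (Finset.mem_image_of_mem _ hx)
    refine Finset.mem_product.2 ⟨Finset.mem_range.2 (by omega), ?_⟩
    rw [Finset.mem_insertNone]
    intro l hl
    rw [Finset.mem_eraseNone, ← Option.mem_def.1 hl]
    exact Finset.mem_image_of_mem _ hx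
  let d : ℕ → Option Node → ℝ := fun p a => if (p, a) ∈ A then c (p, a) else 0
  let D : ℕ → ℝ := fun p => ∑ a ∈ Finset.insertNone F, d p a ^ 2
  let g : ℕ → Lp ℝ 2 muI := fun p => ∑ a ∈ Finset.insertNone F, d p a • quarkletL2 (p, a)
  have hsumA : partialSum w c A = ∑ p ∈ Finset.range M, w p • g p := by
    rw [partialSum, ← Finset.inter_eq_right.2 hMF, ← Finset.sum_ite_mem, Finset.sum_product]
    refine Finset.sum_congr rfl fun p _ => ?_
    rw [Finset.smul_sum]
    refine Finset.sum_congr rfl fun a _ => ?_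
    by_cases h : (p, a) ∈ A
    · simp only [d, if_pos h, smul_smul, mul_comm]
    · simp only [d, if_neg h, zero_smul, smul_zero]
  have hsumD : ∑ x ∈ A, |c x| ^ 2 = ∑ p ∈ Finset.range M, D p := by
    rw [← Finset.inter_eq_right.2 hMF, ← Finset.sum_ite_mem, Finset.sum_product]
    refine Finset.sum_congr rfl fun p _ => Finset.sum_congr rfl fun a _ => ?_
    by_cases h : (p, a) ∈ A
    · simp only [d, if_pos h, sq_abs]
    · simp only [d, if_neg h]
      norm_num
  have hD0 : ∀ p, 0 ≤ D p := fun p => Finset.sum_nonneg fun a _ => sq_nonneg _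
  have hterm : ∀ p, ‖w p • g p‖ ≤ b p * √(32 * D p) := by
    intro p
    rw [norm_smul, Real.norm_eq_abs, abs_of_nonneg (hw p)]
    refine (pow_le_pow_iff_left₀ (mul_nonneg (hw p) (norm_nonneg _))
      (mul_nonneg (hb0 p) (Real.sqrt_nonneg _)) two_ne_zero).1 ?_
    rw [mul_pow, mul_pow, hbsq, Real.sq_sqrt (mul_nonneg (by norm_num) (hD0 p))]
    have := mul_le_mul_of_nonneg_left (norm_sum_degree_sq_le p (d p) F) (sq_nonneg (w p))
    refine this.trans_eq ?_
    simp only [D]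
    ring
  -- Cauchy–Schwarz over the degrees needs only the ℓ2 norm of `b`, which its ℓ1 norm dominates.
  have hbM : ∑ p ∈ Finset.range M, b p ^ 2 ≤ (∑' p, b p) ^ 2 := by
    calc _ ≤ (∑ p ∈ Finset.range M, b p) ^ 2 :=
          Finset.sum_sq_le_sq_sum_of_nonneg fun p _ => hb0 p
      _ ≤ _ := pow_le_pow_left₀ (Finset.sum_nonneg fun p _ => hb0 p)
          (hsum.sum_le_tsum _ fun p _ => hb0 p) 2
  rw [hsumA, hsumD]
  calc ‖∑ p ∈ Finset.range M, w p • g p‖ ^ 2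
      ≤ (∑ p ∈ Finset.range M, b p * √(32 * D p)) ^ 2 :=
        pow_le_pow_left₀ (norm_nonneg _) ((norm_sum_le _ _).trans
          (Finset.sum_le_sum fun p _ => hterm p)) 2
    _ ≤ (∑ p ∈ Finset.range M, b p ^ 2) * ∑ p ∈ Finset.range M, √(32 * D p) ^ 2 :=
        Finset.sum_mul_sq_le_sq_mul_sq _ _ _
    _ = (∑ p ∈ Finset.range M, b p ^ 2) * (32 * ∑ p ∈ Finset.range M, D p) := by
        congr 1
        rw [Finset.mul_sum]
        exact Finset.sum_congr rfl fun p _ => Real.sq_sqrt (mul_nonneg (by norm_num) (hD0 p))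
    _ ≤ (∑' p, b p) ^ 2 * (32 * ∑ p ∈ Finset.range M, D p) := by
        have := Finset.sum_nonneg fun p (_ : p ∈ Finset.range M) => hD0 p
        gcongr
    _ ≤ _ := by
        have := Finset.sum_nonneg fun p (_ : p ∈ Finset.range M) => hD0 p
        nlinarith

/-- Stability of finite sums, applied to `B \ A`, passes to the limit as `B` exhausts all indices.
-/
theorem norm_sub_partialSum_sq_le {w : ℕ → ℝ} {c : QIdx → ℝ} {C : ℝ} (hC : 0 ≤ C)
    (hstab : ∀ A : Finset QIdx, ‖partialSum w c A‖ ^ 2 ≤ C * ∑ x ∈ A, |c x| ^ 2)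
    (hc : Summable fun x => |c x| ^ 2) {f : Lp ℝ 2 muI}
    (hf : HasSum (fun x : QIdx => (c x * w x.1) • quarkletL2 x) f) (A : Finset QIdx) :
    ‖f - partialSum w c A‖ ^ 2 ≤
      C * ∑' x, (A : Set QIdx)ᶜ.indicator (fun x => |c x| ^ 2) x := by
  have hlim : Filter.Tendsto (fun B => ‖partialSum w c B - partialSum w c A‖ ^ 2) Filter.atTop
      (nhds (‖f - partialSum w c A‖ ^ 2)) := ((hf.sub_const _).norm.pow 2)
  refine le_of_tendsto hlim ?_
  filter_upwards [Filter.eventually_ge_atTop A] with B hB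
  have h1 : partialSum w c B - partialSum w c A = partialSum w c (B \ A) := by
    rw [sub_eq_iff_eq_add, partialSum, partialSum, partialSum, Finset.sum_sdiff hB]
  rw [h1]
  refine (hstab _).trans (mul_le_mul_of_nonneg_left ?_ hC)
  calc ∑ x ∈ B \ A, |c x| ^ 2
      = ∑ x ∈ B \ A, (A : Set QIdx)ᶜ.indicator (fun x => |c x| ^ 2) x := by
        refine Finset.sum_congr rfl fun x hx => ?_
        rw [Set.indicator_of_mem (by simpa using (Finset.mem_sdiff.1 hx).2)]
    _ ≤ _ := (hc.indicator _).sum_le_tsum _ fun x _ =>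
        Set.indicator_nonneg (fun _ _ => by positivity) x

end HaarQuarklet

open HaarQuarklet in
theorem lemma4p4 :
    ∃ K : ℕ → ℝ, ∀ w : ℕ → ℝ, (∀ p, 0 ≤ w p) → w 0 = 1 →
      Summable (fun p : ℕ => w p * ((p : ℝ) + 1) ^ (-(1 / 2) : ℝ)) →
      ∃ C : ℝ, 0 < C ∧ ∀ top : Node → Node, IsEnrichment top →
        ∀ c : QIdx → ℝ, Summable (fun x => |c x| ^ 2) →
        ∀ f : MeasureTheory.Lp ℝ 2 muI,
          HasSum (fun x : QIdx => (c x * w x.1) • quarkletL2 x) f →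
        ∀ N : ℕ, 1 ≤ N → ∀ S : ℕ → Finset Node, IsRun (localErr top c) S N →
          ((indices top (trim (localErr top c) (S N)) (refCount (S N))).card : ℝ) ≤
              K ((trim (localErr top c) (S N)).sup Node.level) * N ∧
          ∀ n : ℕ, 1 ≤ n → n ≤ N →
            ‖f - partialSum w c
                (indices top (trim (localErr top c) (S N)) (refCount (S N)))‖ ^ 2 ≤
              C * ((2 * N + 1) / ((N : ℝ) - n + 1)) * bestErr top (localErr top c) n := by
  -- `(L + 1) * 2 ^ L` bounds the number of nodes up to level `L`; see `card_indices_trim_le`.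
  refine ⟨fun L => ((3 * ((L + 1) * 2 ^ L + 1) : ℕ) : ℝ), fun w hw _ hsum => ?_⟩
  obtain ⟨C, hC, hstab⟩ := exists_norm_partialSum_sq_le hw hsum
  refine ⟨C, hC, fun top htop c hc f hf N hN S hS => ⟨?_, fun n hn hnN => ?_⟩⟩
  · dsimp only
    exact_mod_cast hS.card_indices_trim_le hN top
  · have he := isLocalError_localErr htop hc
    have hT := (hS.isTree N le_rfl).trim (localErr top c)
    rw [mul_assoc]
    refine (norm_sub_partialSum_sq_le hC.le (hstab c) hc hf _).trans
      (mul_le_mul_of_nonneg_left ?_ hC.le)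
    exact (tsum_compl_indices_le htop hc hT _).trans (he.globalErr_trim_le hS htop hn hnN)
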